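/- Let $0<q<1$. **The quantum group.** $\mathcal A(SU_q(2))$ is the unital complex algebra generated by $a,a^*,c,c^*$ with relations $ac=qca$, $ac^*=qc^*a$, $cc^*=c^*c$, $c^*a^*=qa^*c^*$, $ca^*=qa^*c$, $a^*a+c^*c=1$, $aa^*+q^2cc^*=1$. The operators $K^{\pm1},E,F$ (left action $\triangleright$ of the quantum enveloping algebra) on $\mathcal A(SU_q(2))$ are the linear maps determined by $K^{\pm1}\triangleright(xy)=(K^{\pm1}\triangleright x)(K^{\pm1}\triangleright y)$ and $X\triangleright(xy)=(X\triangleright x)(K\triangleright y)+(K^{-1}\triangleright x)(X\triangleright y)$ for $X=E,F$, together with $K^{\pm1}\triangleright 1=1$, $E\triangleright 1=F\triangleright 1=0$, $K^{\pm1}\triangleright a=q^{\mp1/2}a$, $K^{\pm1}\triangleright c=q^{\mp1/2}c$, $K^{\pm1}\triangleright a^*=q^{\pm1/2}a^*$, $K^{\pm1}\triangleright c^*=q^{\pm1/2}c^*$, $E\triangleright a=-qc^*$, $E\triangleright c=a^*$, $E\triangleright a^*=E\triangleright c^*=0$, $F\triangleright a^*=c$, $F\triangleright c^*=-q^{-1}a$,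 $F\triangleright a=F\triangleright c=0$. The coordinate algebra of the standard Podleś sphere is $\mathcal A(S^2_q)=\{x\in\mathcal A(SU_q(2)):K\triangleright x=x\}$ (the coinvariants of the right $U(1)$-coaction). **The $4D_+$ calculus.** Put $h=q-q^{-1}$ and $$L_-=q^{1/2}FK^{-1},\quad L_z=\frac{K^{-2}-1}{h},\quad L_+=q^{-1/2}EK^{-1},\quad L_0=\frac{q(K^2-1)+q^{-1}(K^{-2}-1)}{h^2}+FE,$$ and, in the order $(-,z,+,0)$, $$(f_{ab})=\begin{pmatrix}1&0&0&q^{-1/2}KE\\ hq^{1/2}FK^{-1}&K^{-2}&hq^{-1/2}EK^{-1}&h\big[FE+q^{-1}h^{-2}(K^{-2}-K^2)\big]\\0&0&1&q^{-1/2}FK\\0&0&0&K^2\end{pmatrix}.$$ The bimodule $\Omega^1(SU_q(2))$ of 1-forms is the free left $\mathcal A(SU_q(2))$-module with basis $\omega_-,\omega_z,\omega_+,\omega_0$, with right multiplication $\omega_a x=\sum_b(f_{ab}\triangleright x)\,\omega_b$; the differential is $\mathrm d x=\sum_a(L_a\triangleright x)\,\omega_a$. **The exterior algebra.** The braiding $\sigma$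 of the bicovariant bimodule $\Omega^1(SU_q(2))$ is given on the left invariant basis, writing $ab$ for $\omega_a\otimes\omega_b$, by $$\begin{aligned} &\sigma({-}{-})={-}{-},\qquad \sigma({+}{+})={+}{+},\qquad \sigma(00)=00,\qquad \sigma(0z)=z0,\\ &\sigma(zz)=zz+(q^2-q^{-2})(z0+{-}{+}-{+}{-}),\\ &\sigma({-}{+})={+}{-}-z0,\qquad \sigma({+}{-})={-}{+}+z0,\\ &\sigma({-}z)=z{-}+(1+q^2)\,{-}0,\qquad \sigma(z{-})=(1-q^{-2})\,z{-}+q^{-2}\,{-}z-(1+q^{-2})\,{-}0,\\ &\sigma({-}0)=0{-}+(1-q^2)\,{-}0,\qquad \sigma(0{-})=q^2\,{-}0,\\ &\sigma(z{+})=q^2\,{+}z+(1-q^2)\,z{+}+(1+q^2)\,{+}0,\qquad \sigma({+}z)=z{+}-(1+q^{-2})\,{+}0,\\ &\sigma(z0)=0z+h^2({+}{-}-{-}{+})-h^2\,z0,\\ &\sigma({+}0)=0{+}+(1-q^{-2})\,{+}0,\qquad \sigma(0{+})=q^{-2}\,{+}0 . \end{aligned}$$ Let $\mathfrak A^{(k)}=\sum_{\pi\in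 S_k}\mathrm{sgn}(\pi)\,\sigma_\pi$ be the antisymmetrizer of the $k$-fold tensor power of $\Omega^1(SU_q(2))$ over $\mathcal A(SU_q(2))$, where $\sigma_\pi=\sigma_{i_1}\cdots\sigma_{i_r}$ for a reduced word $\pi=s_{i_1}\cdots s_{i_r}$ and $\sigma_i$ is $\sigma$ acting on the tensor factors $i,i+1$. The exterior algebra $(\Omega(SU_q(2)),\wedge)$ is the quotient of the tensor algebra of the bimodule $\Omega^1(SU_q(2))$ over $\mathcal A(SU_q(2))$ by the ideal formed by the kernels $\ker\mathfrak A^{(k)}$, $k\ge 0$. **The restricted calculus.** For $k\ge0$ let $\Omega^k(S^2_q)\subset\Omega(SU_q(2))$ be the linear span of the forms $f_0\,\mathrm d f_1\wedge\dots\wedge\mathrm d f_k$ with $f_0,\dots,f_k\in\mathcal A(S^2_q)$. This is the exterior algebra of the restricted (left covariant, 3-dimensional) calculus on $S^2_q$. **Lemma.** The restricted calculus on $S^2_q$ is non-degenerate: for every $k\in\{0,1,2,3\}$, if $\theta\in\Omega^k(S^2_q)$ satisfies $\theta'\wedge\theta=0$ for all $\theta'\in\Omega^{3-k}(S^2_q)$,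 then $\theta=0$. -/

import Mathlib

open scoped Matrix

noncomputable section

set_option linter.unusedSimpArgs false

namespace QSphere

/-! ## The quantum group `SU_q(2)`, with `0 < q < 1` -/

/-- The deformation parameter `q`, as a complex number. -/
def qC (q : Set.Ioo (0 : ℝ) 1) : ℂ := ((q : ℝ) : ℂ)

/-- The positive square root `q^{1/2}`, as a complex number. -/
def qRt (q : Set.Ioo (0 : ℝ) 1) : ℂ := ((Real.sqrt (q : ℝ) : ℝ) : ℂ)

theorem qRt_mul_self (q : Set.Ioo (0 : ℝ) 1) : qRt q * qRt q = qC q := by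
  unfold qRt qC
  rw [← Complex.ofReal_mul, Real.mul_self_sqrt q.2.1.le]

theorem qC_ne_zero (q : Set.Ioo (0 : ℝ) 1) : qC q ≠ 0 :=
  Complex.ofReal_ne_zero.mpr q.2.1.ne'

theorem qRt_ne_zero (q : Set.Ioo (0 : ℝ) 1) : qRt q ≠ 0 :=
  Complex.ofReal_ne_zero.mpr (Real.sqrt_ne_zero'.mpr q.2.1)

/-- The algebra generators `a, a^*, c, c^*`. -/
inductive Gen : Type
  | a
  | aStar
  | c
  | cStar

/-- The relations of `A(SU_q(2))`: those of the matrix `(a, -q c^*; c, a^*)` being unitary,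
together with their `*`-conjugates. -/
inductive SURel (q : Set.Ioo (0 : ℝ) 1) : FreeAlgebra ℂ Gen → FreeAlgebra ℂ Gen → Prop
  | a_c : SURel q (FreeAlgebra.ι ℂ Gen.a * FreeAlgebra.ι ℂ Gen.c)
      (qC q • (FreeAlgebra.ι ℂ Gen.c * FreeAlgebra.ι ℂ Gen.a))
  | a_cStar : SURel q (FreeAlgebra.ι ℂ Gen.a * FreeAlgebra.ι ℂ Gen.cStar)
      (qC q • (FreeAlgebra.ι ℂ Gen.cStar * FreeAlgebra.ι ℂ Gen.a))
  | c_cStar : SURel q (FreeAlgebra.ι ℂ Gen.c * FreeAlgebra.ι ℂ Gen.cStar)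
      (FreeAlgebra.ι ℂ Gen.cStar * FreeAlgebra.ι ℂ Gen.c)
  | cStar_aStar : SURel q (FreeAlgebra.ι ℂ Gen.cStar * FreeAlgebra.ι ℂ Gen.aStar)
      (qC q • (FreeAlgebra.ι ℂ Gen.aStar * FreeAlgebra.ι ℂ Gen.cStar))
  | c_aStar : SURel q (FreeAlgebra.ι ℂ Gen.c * FreeAlgebra.ι ℂ Gen.aStar)
      (qC q • (FreeAlgebra.ι ℂ Gen.aStar * FreeAlgebra.ι ℂ Gen.c))
  | aStar_a : SURel q (FreeAlgebra.ι ℂ Gen.aStar * FreeAlgebra.ι ℂ Gen.a +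
      FreeAlgebra.ι ℂ Gen.cStar * FreeAlgebra.ι ℂ Gen.c) 1
  | a_aStar : SURel q (FreeAlgebra.ι ℂ Gen.a * FreeAlgebra.ι ℂ Gen.aStar +
      qC q ^ 2 • (FreeAlgebra.ι ℂ Gen.c * FreeAlgebra.ι ℂ Gen.cStar)) 1

/-- The coordinate algebra `A(SU_q(2))`. -/
def SU (q : Set.Ioo (0 : ℝ) 1) : Type := RingQuot (SURel q)

instance (q : Set.Ioo (0 : ℝ) 1) : Ring (SU q) := inferInstanceAs (Ring (RingQuot (SURel q)))

instance (q : Set.Ioo (0 : ℝ) 1) : Algebra ℂ (SU q) :=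
  inferInstanceAs (Algebra ℂ (RingQuot (SURel q)))

/-- The quotient map onto `A(SU_q(2))`. -/
def mkSU (q : Set.Ioo (0 : ℝ) 1) : FreeAlgebra ℂ Gen →ₐ[ℂ] SU q :=
  RingQuot.mkAlgHom ℂ (SURel q)

theorem mkSU_rel (q : Set.Ioo (0 : ℝ) 1) {x y : FreeAlgebra ℂ Gen} (h : SURel q x y) :
    mkSU q x = mkSU q y :=
  RingQuot.mkAlgHom_rel ℂ h

/-- The image of a generator in `A(SU_q(2))`. -/
def gen (q : Set.Ioo (0 : ℝ) 1) (g : Gen) : SU q := mkSU q (FreeAlgebra.ι ℂ g)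

section relations

variable (q : Set.Ioo (0 : ℝ) 1)

theorem rel_a_c : gen q .a * gen q .c = qC q • (gen q .c * gen q .a) := by
  simpa [gen] using mkSU_rel q (SURel.a_c (q := q))

theorem rel_a_cStar : gen q .a * gen q .cStar = qC q • (gen q .cStar * gen q .a) := by
  simpa [gen] using mkSU_rel q (SURel.a_cStar (q := q))

theorem rel_c_cStar : gen q .c * gen q .cStar = gen q .cStar * gen q .c := by
  simpa [gen] using mkSU_rel q (SURel.c_cStar (q := q))

theorem rel_cStar_aStar :
    gen q .cStar * gen q .aStar = qC q • (gen q .aStar * gen q .cStar) := by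
  simpa [gen] using mkSU_rel q (SURel.cStar_aStar (q := q))

theorem rel_c_aStar : gen q .c * gen q .aStar = qC q • (gen q .aStar * gen q .c) := by
  simpa [gen] using mkSU_rel q (SURel.c_aStar (q := q))

theorem rel_aStar_a : gen q .aStar * gen q .a + gen q .cStar * gen q .c = 1 := by
  simpa [gen] using mkSU_rel q (SURel.aStar_a (q := q))

theorem rel_a_aStar :
    gen q .a * gen q .aStar + qC q ^ 2 • (gen q .c * gen q .cStar) = 1 := by
  simpa [gen] using mkSU_rel q (SURel.a_aStar (q := q))

theorem aStar_mul_a : gen q .aStar * gen q .a = 1 - gen q .cStar * gen q .c :=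
  eq_sub_of_add_eq (rel_aStar_a q)

theorem a_mul_aStar :
    gen q .a * gen q .aStar = 1 - qC q ^ 2 • (gen q .cStar * gen q .c) := by
  rw [← rel_c_cStar]
  exact eq_sub_of_add_eq (rel_a_aStar q)

end relations

/-- The elements `a, a', c, c'` of an algebra satisfy the relations of `a, a^*, c, c^*`. -/
structure SatisfiesSURel (q : Set.Ioo (0 : ℝ) 1) {B : Type} [Ring B] [Algebra ℂ B]
    (a a' c c' : B) : Prop where
  a_c : a * c = qC q • (c * a)
  a_cStar : a * c' = qC q • (c' * a)
  c_cStar : c * c' = c' * c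
  cStar_aStar : c' * a' = qC q • (a' * c')
  c_aStar : c * a' = qC q • (a' * c)
  aStar_a : a' * a + c' * c = 1
  a_aStar : a * a' + qC q ^ 2 • (c * c') = 1

/-- The algebra map out of `A(SU_q(2))` determined by images of the generators that satisfy the
defining relations. -/
def liftSU (q : Set.Ioo (0 : ℝ) 1) {B : Type} [Ring B] [Algebra ℂ B] (a a' c c' : B)
    (h : SatisfiesSURel q a a' c c') : SU q →ₐ[ℂ] B :=
  RingQuot.liftAlgHom ℂ ⟨FreeAlgebra.lift ℂ (fun g : Gen => match g with
    | .a => a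
    | .aStar => a'
    | .c => c
    | .cStar => c'), by
      obtain ⟨h₁, h₂, h₃, h₄, h₅, h₆, h₇⟩ := h
      intro x y hxy
      cases hxy <;> simp <;> assumption⟩

/-! ## The left action of the quantum enveloping algebra

The left action `h ▷ x = x₍₁₎ ⟨h, x₍₂₎⟩` of the Hopf algebra generated by `K, K⁻¹, E, F`.  It makes
`A(SU_q(2))` a module algebra, so it is determined by its values on `a, a^*, c, c^*` and by
`Δ K^{±1} = K^{±1} ⊗ K^{±1}`, `Δ E = E ⊗ K + K⁻¹ ⊗ E`, `Δ F = F ⊗ K + K⁻¹ ⊗ F`. -/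

/-- The automorphism `a ↦ u a`, `c ↦ u c`, `a^* ↦ u⁻¹ a^*`, `c^* ↦ u⁻¹ c^*`. -/
def torus (q : Set.Ioo (0 : ℝ) 1) (u : ℂ) (hu : u ≠ 0) : SU q →ₐ[ℂ] SU q :=
  liftSU q (u • gen q .a) (u⁻¹ • gen q .aStar) (u • gen q .c) (u⁻¹ • gen q .cStar)
    (by
      constructor <;> simp only [smul_mul_smul_comm, inv_mul_cancel₀ hu, mul_inv_cancel₀ hu,
        rel_a_c, rel_a_cStar, rel_c_cStar, rel_cStar_aStar, rel_c_aStar, one_smul, rel_aStar_a]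
      all_goals first | module | rw [← rel_c_cStar, rel_a_aStar])

/-- The action of `K`: `a ↦ q^{-1/2} a`, `c ↦ q^{-1/2} c`, `a^* ↦ q^{1/2} a^*`,
`c^* ↦ q^{1/2} c^*`, multiplicative. -/
def actK (q : Set.Ioo (0 : ℝ) 1) : SU q →ₐ[ℂ] SU q :=
  torus q (qRt q)⁻¹ (inv_ne_zero (qRt_ne_zero q))

/-- The action of `K⁻¹`. -/
def actKinv (q : Set.Ioo (0 : ℝ) 1) : SU q →ₐ[ℂ] SU q :=
  torus q (qRt q) (qRt_ne_zero q)

/-- The algebra map `x ↦ (K⁻¹ ▷ x, E ▷ x; 0, K ▷ x)`; multiplicativity of its upper right entry is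
`E ▷ (x y) = (E ▷ x)(K ▷ y) + (K⁻¹ ▷ x)(E ▷ y)`. On generators,
`E ▷ a = -q c^*`, `E ▷ c = a^*`, `E ▷ a^* = E ▷ c^* = 0`. -/
def matE (q : Set.Ioo (0 : ℝ) 1) : SU q →ₐ[ℂ] Matrix (Fin 2) (Fin 2) (SU q) :=
  liftSU q
    !![qRt q • gen q .a, -(qC q • gen q .cStar); 0, (qRt q)⁻¹ • gen q .a]
    !![(qRt q)⁻¹ • gen q .aStar, 0; 0, qRt q • gen q .aStar]
    !![qRt q • gen q .c, gen q .aStar; 0, (qRt q)⁻¹ • gen q .c]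
    !![(qRt q)⁻¹ • gen q .cStar, 0; 0, qRt q • gen q .cStar]
    (by
      have hs := qRt_ne_zero q
      constructor <;> ext i j <;> fin_cases i <;> fin_cases j <;> simp
      all_goals try simp only [rel_a_c, rel_a_cStar, rel_c_cStar, rel_cStar_aStar, rel_c_aStar,
        aStar_mul_a, a_mul_aStar, ← qRt_mul_self]
      all_goals match_scalars <;> field_simp <;> try ring)

/-- The algebra map `x ↦ (K⁻¹ ▷ x, F ▷ x; 0, K ▷ x)`; multiplicativity of its upper right entry is
`F ▷ (x y) = (F ▷ x)(K ▷ y) + (K⁻¹ ▷ x)(F ▷ y)`. On generators,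
`F ▷ a^* = c`, `F ▷ c^* = -q⁻¹ a`, `F ▷ a = F ▷ c = 0`. -/
def matF (q : Set.Ioo (0 : ℝ) 1) : SU q →ₐ[ℂ] Matrix (Fin 2) (Fin 2) (SU q) :=
  liftSU q
    !![qRt q • gen q .a, 0; 0, (qRt q)⁻¹ • gen q .a]
    !![(qRt q)⁻¹ • gen q .aStar, gen q .c; 0, qRt q • gen q .aStar]
    !![qRt q • gen q .c, 0; 0, (qRt q)⁻¹ • gen q .c]
    !![(qRt q)⁻¹ • gen q .cStar, -((qC q)⁻¹ • gen q .a); 0, qRt q • gen q .cStar]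
    (by
      have hs := qRt_ne_zero q
      constructor <;> ext i j <;> fin_cases i <;> fin_cases j <;> simp
      all_goals try simp only [rel_a_c, rel_a_cStar, rel_c_cStar, rel_cStar_aStar, rel_c_aStar,
        aStar_mul_a, a_mul_aStar, ← qRt_mul_self]
      all_goals match_scalars <;> field_simp <;> try ring)

/-- `K ▷ ·` as a linear operator. -/
def opK (q : Set.Ioo (0 : ℝ) 1) : Module.End ℂ (SU q) := (actK q).toLinearMap

/-- `K⁻¹ ▷ ·` as a linear operator. -/
def opKinv (q : Set.Ioo (0 : ℝ) 1) : Module.End ℂ (SU q) := (actKinv q).toLinearMap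

/-- `E ▷ ·` as a linear operator. -/
def opE (q : Set.Ioo (0 : ℝ) 1) : Module.End ℂ (SU q) where
  toFun x := matE q x 0 1
  map_add' x y := by simp
  map_smul' r x := by simp

/-- `F ▷ ·` as a linear operator. -/
def opF (q : Set.Ioo (0 : ℝ) 1) : Module.End ℂ (SU q) where
  toFun x := matF q x 0 1
  map_add' x y := by simp
  map_smul' r x := by simp

/-- The coordinate algebra `A(S²_q)` of the standard Podleś sphere: the coinvariants of the right
`U(1)`-coaction, that is, the elements with `K ▷ x = x`. -/
def sphere (q : Set.Ioo (0 : ℝ) 1) : Subalgebra ℂ (SU q) :=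
  AlgHom.equalizer (actK q) (AlgHom.id ℂ (SU q))

/-! ## The `4D₊` bicovariant calculus on `SU_q(2)`

The index set `{-, z, +, 0}` of the left invariant basis `ω₋, ω_z, ω₊, ω₀` is `Fin 4`, in this
order.  A product of operators is their composition. -/

/-- `q - q⁻¹`. -/
def qDiff (q : Set.Ioo (0 : ℝ) 1) : ℂ := qC q - (qC q)⁻¹

/-- The basis `L₋, L_z, L₊, L₀` of the quantum tangent space, acting on `A(SU_q(2))`. -/
def opL (q : Set.Ioo (0 : ℝ) 1) : Fin 4 → Module.End ℂ (SU q) :=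
  ![qRt q • (opF q * opKinv q),
    (qDiff q)⁻¹ • (opKinv q ^ 2 - 1),
    (qRt q)⁻¹ • (opE q * opKinv q),
    (qDiff q ^ 2)⁻¹ • (qC q • (opK q ^ 2 - 1) + (qC q)⁻¹ • (opKinv q ^ 2 - 1)) + opF q * opE q]

/-- The elements `f_{ab}` with `Δ L_b = 1 ⊗ L_b + ∑ₐ L_a ⊗ f_{ab}`, acting on `A(SU_q(2))`. -/
def opf (q : Set.Ioo (0 : ℝ) 1) : Matrix (Fin 4) (Fin 4) (Module.End ℂ (SU q)) :=
  !![1, 0, 0, (qRt q)⁻¹ • (opK q * opE q);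
     (qDiff q * qRt q) • (opF q * opKinv q), opKinv q ^ 2,
       (qDiff q * (qRt q)⁻¹) • (opE q * opKinv q),
       qDiff q • (opF q * opE q +
         ((qC q)⁻¹ * (qDiff q ^ 2)⁻¹) • (opKinv q ^ 2 - opK q ^ 2));
     0, 0, 1, (qRt q)⁻¹ • (opF q * opK q);
     0, 0, 0, opK q ^ 2]

/-- The basis tensor `ω_n ⊗ ω_k`. -/
def tens (n k : Fin 4) : Matrix (Fin 4) (Fin 4) ℂ := Matrix.single n k 1

/-- The braiding of the bicovariant bimodule of 1-forms (the bimodule map with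
`σ(ω ⊗ η) = η ⊗ ω` for `ω` left invariant and `η` right invariant), on the left invariant basis:
the entry `(a, b)` is `σ(ω_a ⊗ ω_b) = ∑ σ_{ab}^{nk} ω_n ⊗ ω_k`, as the matrix
`(σ_{ab}^{nk})_{n,k}`. -/
def braid (q : Set.Ioo (0 : ℝ) 1) : Matrix (Fin 4) (Fin 4) (Matrix (Fin 4) (Fin 4) ℂ) :=
  let p : ℂ := qC q ^ 2
  let d : ℂ := qDiff q ^ 2
  !![tens 0 0,
      tens 1 0 + (1 + p) • tens 0 3,
      tens 2 0 - tens 1 3,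
      tens 3 0 + (1 - p) • tens 0 3;
     (1 - p⁻¹) • tens 1 0 + p⁻¹ • tens 0 1 - (1 + p⁻¹) • tens 0 3,
      tens 1 1 + (p - p⁻¹) • (tens 1 3 + tens 0 2 - tens 2 0),
      p • tens 2 1 + (1 - p) • tens 1 2 + (1 + p) • tens 2 3,
      tens 3 1 + d • (tens 2 0 - tens 0 2) - d • tens 1 3;
     tens 0 2 + tens 1 3,
      tens 1 2 - (1 + p⁻¹) • tens 2 3,
      tens 2 2,
      tens 3 2 + (1 - p⁻¹) • tens 2 3;
     p • tens 0 3,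
      tens 1 3,
      p⁻¹ • tens 2 3,
      tens 3 3]

/-- The `k`-fold tensor power of the span of `ω₋, ω_z, ω₊, ω₀`: the function `v` stands for
`∑ v(i₁,…,i_k) ω_{i₁} ⊗ ⋯ ⊗ ω_{i_k}`. -/
abbrev InvTensor (k : ℕ) : Type := (Fin k → Fin 4) → ℂ

/-- `id ⊗ X`, acting by `X` on all but the first tensor factor. -/
def onTail {k : ℕ} (X : Module.End ℂ (InvTensor k)) : Module.End ℂ (InvTensor (k + 1)) where
  toFun v w := X (fun u => v (Fin.cons (w 0) u)) (Fin.tail w)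
  map_add' v v' := by
    funext w
    exact congrFun (X.map_add (fun u => v (Fin.cons (w 0) u)) (fun u => v' (Fin.cons (w 0) u))) _
  map_smul' r v := by
    funext w
    exact congrFun (X.map_smul r (fun u => v (Fin.cons (w 0) u))) _

/-- `σ₁ = σ ⊗ id ⊗ ⋯ ⊗ id`, the braiding of the first two tensor factors. -/
def braidHead (q : Set.Ioo (0 : ℝ) 1) (k : ℕ) : Module.End ℂ (InvTensor (k + 2)) where
  toFun v w := ∑ a, ∑ b, braid q a b (w 0) (w 1) *
    v (Fin.cons a (Fin.cons b (Fin.tail (Fin.tail w))))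
  map_add' v v' := by
    funext w
    simp [mul_add, Finset.sum_add_distrib]
  map_smul' r v := by
    funext w
    simp [Finset.mul_sum, mul_left_comm]

/-- `1 - σ₁ + σ₂ σ₁ - ⋯ + (-1)^k σ_k ⋯ σ₂ σ₁` on the `(k+1)`-st tensor power. -/
def cosetSum (q : Set.Ioo (0 : ℝ) 1) : (k : ℕ) → Module.End ℂ (InvTensor (k + 1))
  | 0 => 1
  | k + 1 => 1 - onTail (cosetSum q k) * braidHead q k

/-- The antisymmetrizer `∑_{π ∈ S_k} sgn(π) σ_π` on the `k`-th tensor power, where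
`σ_π = σ_{i₁} ⋯ σ_{i_r}` for a reduced word `π = s_{i₁} ⋯ s_{i_r}`.  Every permutation of `k + 1`
letters is uniquely `s_j ⋯ s₁ π'` with `0 ≤ j ≤ k` and `π'` fixing the first letter, lengths
adding up; this gives the recursion. -/
def antisymmetrizer (q : Set.Ioo (0 : ℝ) 1) : (k : ℕ) → Module.End ℂ (InvTensor k)
  | 0 => 1
  | k + 1 => cosetSum q k * onTail (antisymmetrizer q k)

/-! ## The exterior algebra `Ω(SU_q(2))` -/

/-- The relations of the exterior algebra, on one symbol for each element of `A(SU_q(2))` and the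
symbols `ω₋, ω_z, ω₊, ω₀`. The first three make `A(SU_q(2))` map as an algebra, the fourth is the
bimodule structure `ω_a x = ∑_b (f_{ab} ▷ x) ω_b` of the left-free module of 1-forms, so that these
four define its tensor algebra over `A(SU_q(2))`; the fifth quotients the `k`-fold tensor power by
the kernel of the antisymmetrizer, for every `k`. -/
inductive FormRel (q : Set.Ioo (0 : ℝ) 1) :
    FreeAlgebra ℂ (SU q ⊕ Fin 4) → FreeAlgebra ℂ (SU q ⊕ Fin 4) → Prop
  | add (x y : SU q) : FormRel q (FreeAlgebra.ι ℂ (Sum.inl (x + y)))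
      (FreeAlgebra.ι ℂ (Sum.inl x) + FreeAlgebra.ι ℂ (Sum.inl y))
  | mul (x y : SU q) : FormRel q (FreeAlgebra.ι ℂ (Sum.inl (x * y)))
      (FreeAlgebra.ι ℂ (Sum.inl x) * FreeAlgebra.ι ℂ (Sum.inl y))
  | scalar (r : ℂ) : FormRel q (FreeAlgebra.ι ℂ (Sum.inl (algebraMap ℂ (SU q) r)))
      (algebraMap ℂ (FreeAlgebra ℂ (SU q ⊕ Fin 4)) r)
  | bimodule (a : Fin 4) (x : SU q) :
      FormRel q (FreeAlgebra.ι ℂ (Sum.inr a) * FreeAlgebra.ι ℂ (Sum.inl x))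
        (∑ b, FreeAlgebra.ι ℂ (Sum.inl (opf q a b x)) * FreeAlgebra.ι ℂ (Sum.inr b))
  | wedge (k : ℕ) (v : InvTensor k) (hv : antisymmetrizer q k v = 0) :
      FormRel q (∑ w, v w • (List.ofFn fun i => FreeAlgebra.ι ℂ (Sum.inr (w i))).prod) 0

/-- The exterior algebra `Ω(SU_q(2))` of the `4D₊` calculus; its product is the wedge product. -/
def Forms (q : Set.Ioo (0 : ℝ) 1) : Type := RingQuot (FormRel q)

instance (q : Set.Ioo (0 : ℝ) 1) : Ring (Forms q) :=
  inferInstanceAs (Ring (RingQuot (FormRel q)))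

instance (q : Set.Ioo (0 : ℝ) 1) : Algebra ℂ (Forms q) :=
  inferInstanceAs (Algebra ℂ (RingQuot (FormRel q)))

/-- The quotient map onto `Ω(SU_q(2))`. -/
def mkForms (q : Set.Ioo (0 : ℝ) 1) : FreeAlgebra ℂ (SU q ⊕ Fin 4) →ₐ[ℂ] Forms q :=
  RingQuot.mkAlgHom ℂ (FormRel q)

theorem mkForms_rel (q : Set.Ioo (0 : ℝ) 1) {x y : FreeAlgebra ℂ (SU q ⊕ Fin 4)}
    (h : FormRel q x y) : mkForms q x = mkForms q y :=
  RingQuot.mkAlgHom_rel ℂ h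

/-- The inclusion of functions as 0-forms. -/
def fn (q : Set.Ioo (0 : ℝ) 1) : SU q →ₐ[ℂ] Forms q :=
  AlgHom.ofLinearMap
    { toFun := fun x => mkForms q (FreeAlgebra.ι ℂ (Sum.inl x))
      map_add' := fun x y => by rw [mkForms_rel q (FormRel.add x y), map_add]
      map_smul' := fun r x => by
        rw [Algebra.smul_def, mkForms_rel q (FormRel.mul _ x), map_mul,
          mkForms_rel q (FormRel.scalar r), AlgHom.commutes, RingHom.id_apply,
          Algebra.smul_def] }
    (by
      have h := mkForms_rel q (FormRel.scalar 1)
      rw [map_one, map_one, map_one] at h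
      exact h)
    (fun x y => by
      change mkForms q _ = mkForms q _ * mkForms q _
      rw [mkForms_rel q (FormRel.mul x y), map_mul])

/-- The left invariant 1-forms `ω₋, ω_z, ω₊, ω₀`. -/
def omega (q : Set.Ioo (0 : ℝ) 1) (a : Fin 4) : Forms q :=
  mkForms q (FreeAlgebra.ι ℂ (Sum.inr a))

/-- The differential on functions, `d x = ∑ₐ (L_a ▷ x) ω_a`. -/
def diff (q : Set.Ioo (0 : ℝ) 1) : SU q →ₗ[ℂ] Forms q :=
  ∑ a, (LinearMap.mulRight ℂ (omega q a)) ∘ₗ (fn q).toLinearMap ∘ₗ opL q a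

/-! ## The restricted calculus on the quantum sphere -/

/-- The `k`-forms `Ω^k(S²_q)` of the calculus restricted to the sphere: the span in `Ω(SU_q(2))` of
the forms `f₀ df₁ ∧ ⋯ ∧ df_k` with `f₀, …, f_k` in `A(S²_q)`. -/
def sphereForms (q : Set.Ioo (0 : ℝ) 1) (k : ℕ) : Submodule ℂ (Forms q) :=
  (Subalgebra.toSubmodule (sphere q)).map (fn q).toLinearMap *
    ((Subalgebra.toSubmodule (sphere q)).map (diff q)) ^ k

end QSphere

end

/-! On the sphere `K` acts trivially, so `L_z` and the `K`-part of `L_0` vanish there, and `d x`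
involves only `ω₋, ω₊, ω₀`. The span of these three is stable under right multiplication by
functions, and they anticommute and square to zero. Hence a sphere form of degree 1 or 2 is a
combination, with coefficients in `A(SU_q(2))` of prescribed `K`-weight, of the expected monomials
(`exists_oneForm`, `exists_twoForm`), and every 3-form that arises is a multiple of `ω₋ω₊ω₀`.

If `ω₋, ω₊, ω₀` were sphere forms, wedging with complementary monomials would isolate each
coefficient. `ω₀` is one (`omega_zero_mem`). For `ω₋` and `ω₊` the substitutes are `y ω₋` and `y ω₊`
with `y` of weight `q⁻¹`, respectively `q` (`fn_mul_omega_minus_mem`, `fn_mul_omega_plus_mem`).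
Taking for `y` the quadratic elements `quadMinus` and `quadPlus` loses nothing: each family
generates the unit left ideal, so an element killed by left multiplication with a whole family is
zero (`eq_zero_of_quadMinus_mul`, `eq_zero_of_quadPlus_mul`). In degree 3 the test form is the
0-form `1`.

It remains to know that `x ω₋ω₊ω₀ = 0` forces `x = 0` in an algebra given by generators and
relations (`eq_zero_of_fn_mul_volume`). For this a representation is built. The braiding commutes
with right multiplication by functions (`braid_opf`), hence so do the antisymmetrizers, and their
kernels are stable. So any matrices for the `ω_a` that satisfy the relations among invariant forms
induce a representation of all forms on tuples of functions (`formsRep`). A graded space of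
dimension `1 + 4 + 4 + 1`, whose structure constants are one row of the third antisymmetrizer,
serves as the invariant part; on it `ω₋ω₊ω₀` acts nontrivially. -/

noncomputable section

set_option linter.unusedSimpArgs false
set_option linter.unnecessarySeqFocus false

namespace QSphere

/-! ### The module algebra action and the coproduct of the `f_{ab}` -/

section action

variable (q : Set.Ioo (0 : ℝ) 1)

theorem qDiff_ne_zero : qDiff q ≠ 0 := by
  have h0 : (0 : ℝ) < q := q.2.1
  have h1 : (q : ℝ) < 1 := q.2.2
  have h : ((q : ℝ) - (q : ℝ)⁻¹) ≠ 0 := by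
    have : 1 < (q : ℝ)⁻¹ := (one_lt_inv₀ h0).2 h1
    linarith
  unfold qDiff qC
  exact_mod_cast h

theorem liftSU_gen {B : Type} [Ring B] [Algebra ℂ B] (a a' c c' : B)
    (h : SatisfiesSURel q a a' c c') :
    liftSU q a a' c c' h (gen q .a) = a ∧ liftSU q a a' c c' h (gen q .aStar) = a' ∧
      liftSU q a a' c c' h (gen q .c) = c ∧ liftSU q a a' c c' h (gen q .cStar) = c' := by
  refine ⟨?_, ?_, ?_, ?_⟩ <;>
  · unfold liftSU gen mkSU
    erw [RingQuot.liftAlgHom_mkAlgHom_apply]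
    simp

/-- An induction principle for `A(SU_q(2))`. -/
theorem SU.induction {P : SU q → Prop} (hgen : ∀ g, P (gen q g))
    (halg : ∀ r : ℂ, P (algebraMap ℂ (SU q) r)) (hadd : ∀ x y, P x → P y → P (x + y))
    (hmul : ∀ x y, P x → P y → P (x * y)) (x : SU q) : P x := by
  obtain ⟨y, rfl⟩ : ∃ y, mkSU q y = x := RingQuot.mkAlgHom_surjective ℂ (SURel q) x
  induction y using FreeAlgebra.induction with
  | grade0 r => rw [AlgHom.commutes]; exact halg r
  | grade1 g => exact hgen g
  | mul x y hx hy => rw [map_mul]; exact hmul _ _ hx hy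
  | add x y hx hy => rw [map_add]; exact hadd _ _ hx hy

theorem opK_gen : opK q (gen q .a) = (qRt q)⁻¹ • gen q .a ∧
    opK q (gen q .aStar) = qRt q • gen q .aStar ∧ opK q (gen q .c) = (qRt q)⁻¹ • gen q .c ∧
      opK q (gen q .cStar) = qRt q • gen q .cStar := by
  simp [opK, actK, torus, liftSU_gen]

theorem opKinv_gen : opKinv q (gen q .a) = qRt q • gen q .a ∧
    opKinv q (gen q .aStar) = (qRt q)⁻¹ • gen q .aStar ∧ opKinv q (gen q .c) = qRt q • gen q .c ∧
      opKinv q (gen q .cStar) = (qRt q)⁻¹ • gen q .cStar := by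
  simp [opKinv, actKinv, torus, liftSU_gen]

theorem opE_gen : opE q (gen q .a) = -(qC q • gen q .cStar) ∧ opE q (gen q .aStar) = 0 ∧
    opE q (gen q .c) = gen q .aStar ∧ opE q (gen q .cStar) = 0 := by
  simp [opE, matE, liftSU_gen]

theorem opF_gen : opF q (gen q .a) = 0 ∧ opF q (gen q .aStar) = gen q .c ∧
    opF q (gen q .c) = 0 ∧ opF q (gen q .cStar) = -((qC q)⁻¹ • gen q .a) := by
  simp [opF, matF, liftSU_gen]

theorem opK_mul (x y : SU q) : opK q (x * y) = opK q x * opK q y := map_mul (actK q) x y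

theorem opKinv_mul (x y : SU q) : opKinv q (x * y) = opKinv q x * opKinv q y :=
  map_mul (actKinv q) x y

theorem opK_algebraMap (r : ℂ) : opK q (algebraMap ℂ _ r) = algebraMap ℂ _ r :=
  (actK q).commutes r

theorem opKinv_algebraMap (r : ℂ) : opKinv q (algebraMap ℂ _ r) = algebraMap ℂ _ r :=
  (actKinv q).commutes r

/-- Identifies the diagonal, so that the twisted Leibniz rule for `E` can be read off the upper
right entry of a product of triangular matrices. -/
theorem matE_diag (x : SU q) :
    matE q x 0 0 = opKinv q x ∧ matE q x 1 1 = opK q x ∧ matE q x 1 0 = 0 := by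
  induction x using SU.induction q with
  | hgen g => cases g <;> simp [opK_gen, opKinv_gen, matE, liftSU_gen]
  | halg r => simp [Matrix.algebraMap_matrix_apply, opK_algebraMap, opKinv_algebraMap]
  | hadd x y hx hy => simp [hx, hy]
  | hmul x y hx hy => simp [hx, hy, Matrix.mul_apply, opK_mul, opKinv_mul]

theorem matF_diag (x : SU q) :
    matF q x 0 0 = opKinv q x ∧ matF q x 1 1 = opK q x ∧ matF q x 1 0 = 0 := by
  induction x using SU.induction q with
  | hgen g => cases g <;> simp [opK_gen, opKinv_gen, matF, liftSU_gen]
  | halg r => simp [Matrix.algebraMap_matrix_apply, opK_algebraMap, opKinv_algebraMap]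
  | hadd x y hx hy => simp [hx, hy]
  | hmul x y hx hy => simp [hx, hy, Matrix.mul_apply, opK_mul, opKinv_mul]

theorem opE_mul (x y : SU q) : opE q (x * y) = opE q x * opK q y + opKinv q x * opE q y := by
  change matE q (x * y) 0 1 = _
  rw [map_mul, Matrix.mul_apply, Fin.sum_univ_two, (matE_diag q x).1, (matE_diag q y).2.1, add_comm]
  rfl

theorem opF_mul (x y : SU q) : opF q (x * y) = opF q x * opK q y + opKinv q x * opF q y := by
  change matF q (x * y) 0 1 = _
  rw [map_mul, Matrix.mul_apply, Fin.sum_univ_two, (matF_diag q x).1, (matF_diag q y).2.1, add_comm]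
  rfl

theorem opE_algebraMap (r : ℂ) : opE q (algebraMap ℂ _ r) = 0 := by
  simp [opE, Matrix.algebraMap_matrix_apply]

theorem opF_algebraMap (r : ℂ) : opF q (algebraMap ℂ _ r) = 0 := by
  simp [opF, Matrix.algebraMap_matrix_apply]

theorem opK_opKinv (x : SU q) : opK q (opKinv q x) = x := by
  have hs := qRt_ne_zero q
  induction x using SU.induction q with
  | hgen g => cases g <;> simp [opK_gen, opKinv_gen, hs]
  | halg r => simp [opK_algebraMap, opKinv_algebraMap]
  | hadd x y hx hy => simp [hx, hy]
  | hmul x y hx hy => simp [hx, hy, opK_mul, opKinv_mul]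

theorem opKinv_opK (x : SU q) : opKinv q (opK q x) = x := by
  have hs := qRt_ne_zero q
  induction x using SU.induction q with
  | hgen g => cases g <;> simp [opK_gen, opKinv_gen, hs]
  | halg r => simp [opK_algebraMap, opKinv_algebraMap]
  | hadd x y hx hy => simp [hx, hy]
  | hmul x y hx hy => simp [hx, hy, opK_mul, opKinv_mul]

theorem opK_opE (x : SU q) : opK q (opE q x) = qC q • opE q (opK q x) := by
  have hs := qRt_ne_zero q
  induction x using SU.induction q with
  | hgen g =>
    cases g <;> simp [opK_gen, opE_gen, ← qRt_mul_self]
    all_goals match_scalars <;> field_simp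
  | halg r => simp [opK_algebraMap, opE_algebraMap]
  | hadd x y hx hy => simp [hx, hy]
  | hmul x y hx hy => simp [hx, hy, opE_mul, opK_mul, opK_opKinv, opKinv_opK]

theorem opK_opF (x : SU q) : opK q (opF q x) = (qC q)⁻¹ • opF q (opK q x) := by
  have hs := qRt_ne_zero q
  induction x using SU.induction q with
  | hgen g =>
    cases g <;> simp [opK_gen, opF_gen, ← qRt_mul_self]
    all_goals match_scalars <;> field_simp
  | halg r => simp [opK_algebraMap, opF_algebraMap]
  | hadd x y hx hy => simp [hx, hy]
  | hmul x y hx hy => simp [hx, hy, opF_mul, opK_mul, opK_opKinv, opKinv_opK]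

theorem opKinv_opE (x : SU q) : opKinv q (opE q x) = (qC q)⁻¹ • opE q (opKinv q x) := by
  have h := congrArg (opKinv q) (opK_opE q (opKinv q x))
  rw [opKinv_opK, opK_opKinv, map_smul] at h
  rw [h, inv_smul_smul₀ (qC_ne_zero q)]

/-- The coproduct of the `f_{ab}`. -/
theorem opf_mul (a b : Fin 4) (x y : SU q) :
    opf q a b (x * y) = ∑ c, opf q a c x * opf q c b y := by
  have hs := qRt_ne_zero q
  have hh := qDiff_ne_zero q
  fin_cases a <;> fin_cases b <;>
    simp [opf, Fin.sum_univ_four, pow_two, opK_mul, opKinv_mul, opE_mul, opF_mul, opK_opKinv,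
      opKinv_opK, opKinv_opE, opK_opE, mul_add, add_mul, smul_add, mul_sub,
      sub_mul, smul_sub, smul_smul, ← qRt_mul_self]
  all_goals match_scalars <;> field_simp <;> try ring

theorem opf_algebraMap (a b : Fin 4) (r : ℂ) :
    opf q a b (algebraMap ℂ _ r) = if a = b then algebraMap ℂ _ r else 0 := by
  fin_cases a <;> fin_cases b <;>
    simp [opf, pow_two, opK_algebraMap, opKinv_algebraMap, opE_algebraMap, opF_algebraMap]

end action

/-! ### Compatibility of the braiding with right multiplication by functions -/

section braiding

variable (q : Set.Ioo (0 : ℝ) 1)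

/-- `e, e'` is a basis of a spin `1/2` representation. -/
structure IsDoublet (e e' : SU q) : Prop where
  K_fst : opK q e = (qRt q)⁻¹ • e
  K_snd : opK q e' = qRt q • e'
  Kinv_fst : opKinv q e = qRt q • e
  Kinv_snd : opKinv q e' = (qRt q)⁻¹ • e'
  E_fst : opE q e = e'
  E_snd : opE q e' = 0
  F_fst : opF q e = 0
  F_snd : opF q e' = e

/-- Together with the doublet `c, a^*` this covers all four generators up to scalars, so identities
for the `f_{ab}` on generators need to be checked only on an abstract doublet. -/
theorem isDoublet_a : IsDoublet q (gen q .a) (-(qC q • gen q .cStar)) := by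
  have hq := qC_ne_zero q
  constructor <;> simp [opK_gen, opKinv_gen, opE_gen, opF_gen, hq]
  all_goals module

theorem isDoublet_c : IsDoublet q (gen q .c) (gen q .aStar) := by
  constructor <;> simp [opK_gen, opKinv_gen, opE_gen, opF_gen]

variable {q}

theorem IsDoublet.opf_fst {e e' : SU q} (h : IsDoublet q e e') (a b : Fin 4) :
    opf q a b e = !![e, 0, 0, e'; 0, qC q • e, qDiff q • e', qC q • e; 0, 0, e, 0;
      0, 0, 0, (qC q)⁻¹ • e] a b := by
  have hs := qRt_ne_zero q
  have hq := qC_ne_zero q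
  have hh := qDiff_ne_zero q
  obtain ⟨h1, h2, h3, h4, h5, h6, h7, h8⟩ := h
  fin_cases a <;> fin_cases b <;> simp [opf, pow_two, *]
  all_goals match_scalars <;> field_simp <;> try (simp only [qDiff, ← qRt_mul_self]; field_simp; try ring)

theorem IsDoublet.opf_snd {e e' : SU q} (h : IsDoublet q e e') (a b : Fin 4) :
    opf q a b e' = !![e', 0, 0, 0; qDiff q • e, (qC q)⁻¹ • e', 0, -((qC q)⁻¹ • e'); 0, 0, e', e;
      0, 0, 0, qC q • e'] a b := by
  have hs := qRt_ne_zero q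
  have hq := qC_ne_zero q
  have hh := qDiff_ne_zero q
  obtain ⟨h1, h2, h3, h4, h5, h6, h7, h8⟩ := h
  fin_cases a <;> fin_cases b <;> simp [opf, pow_two, *]
  all_goals match_scalars <;> field_simp <;> try (simp only [qDiff, ← qRt_mul_self]; field_simp; try ring)

theorem braid_apply (q : Set.Ioo (0 : ℝ) 1) :
    braid q 0 0 = tens 0 0 ∧
    braid q 0 1 = tens 1 0 + (1 + qC q ^ 2) • tens 0 3 ∧
    braid q 0 2 = tens 2 0 - tens 1 3 ∧
    braid q 0 3 = tens 3 0 + (1 - qC q ^ 2) • tens 0 3 ∧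
    braid q 1 0 = (1 - (qC q ^ 2)⁻¹) • tens 1 0 + (qC q ^ 2)⁻¹ • tens 0 1 -
      (1 + (qC q ^ 2)⁻¹) • tens 0 3 ∧
    braid q 1 1 = tens 1 1 + (qC q ^ 2 - (qC q ^ 2)⁻¹) • (tens 1 3 + tens 0 2 - tens 2 0) ∧
    braid q 1 2 = qC q ^ 2 • tens 2 1 + (1 - qC q ^ 2) • tens 1 2 + (1 + qC q ^ 2) • tens 2 3 ∧
    braid q 1 3 = tens 3 1 + qDiff q ^ 2 • (tens 2 0 - tens 0 2) - qDiff q ^ 2 • tens 1 3 ∧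
    braid q 2 0 = tens 0 2 + tens 1 3 ∧
    braid q 2 1 = tens 1 2 - (1 + (qC q ^ 2)⁻¹) • tens 2 3 ∧
    braid q 2 2 = tens 2 2 ∧
    braid q 2 3 = tens 3 2 + (1 - (qC q ^ 2)⁻¹) • tens 2 3 ∧
    braid q 3 0 = qC q ^ 2 • tens 0 3 ∧
    braid q 3 1 = tens 1 3 ∧
    braid q 3 2 = (qC q ^ 2)⁻¹ • tens 2 3 ∧
    braid q 3 3 = tens 3 3 :=
  ⟨rfl, rfl, rfl, rfl, rfl, rfl, rfl, rfl, rfl, rfl, rfl, rfl, rfl, rfl, rfl, rfl⟩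

variable (q)

/-- `∑ₙ (f_{cn} ▷ x) ω_n ⊗ ω_k`, as a matrix. -/
def rowOne (c k : Fin 4) : SU q →ₗ[ℂ] Matrix (Fin 4) (Fin 4) (SU q) :=
  ∑ n, (Matrix.singleLinearMap ℂ n k) ∘ₗ opf q c n

/-- `∑ₙₖ (f_{cn} f_{dk} ▷ x) ω_n ⊗ ω_k`, as a matrix. -/
def rowTwo (c d : Fin 4) : SU q →ₗ[ℂ] Matrix (Fin 4) (Fin 4) (SU q) :=
  ∑ k, rowOne q c k ∘ₗ opf q d k

/-- The linear extension of `rowTwo` in its indices. -/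
def rowExt (x : SU q) : Matrix (Fin 4) (Fin 4) ℂ →ₗ[ℂ] Matrix (Fin 4) (Fin 4) (SU q) where
  toFun u := ∑ c, ∑ d, u c d • rowTwo q c d x
  map_add' u v := by simp [add_smul, Finset.sum_add_distrib]
  map_smul' r u := by simp [mul_smul, Finset.smul_sum]

/-- The embedding of `u` as `x • u`. -/
def constMat (x : SU q) : Matrix (Fin 4) (Fin 4) ℂ →ₗ[ℂ] Matrix (Fin 4) (Fin 4) (SU q) where
  toFun u := u.map (· • x)
  map_add' u v := by ext; simp [add_smul]
  map_smul' r u := by ext; simp [mul_smul]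

theorem constMat_apply (x : SU q) (u : Matrix (Fin 4) (Fin 4) ℂ) (n k : Fin 4) :
    constMat q x u n k = u n k • x :=
  rfl

/-- The braiding with coefficients in `A(SU_q(2))`. -/
def braidMat : Matrix (Fin 4) (Fin 4) (SU q) →ₗ[ℂ] Matrix (Fin 4) (Fin 4) (SU q) where
  toFun u := ∑ c, ∑ d, constMat q (u c d) (braid q c d)
  map_add' u v := by ext; simp [constMat_apply, Matrix.sum_apply, Finset.sum_add_distrib]
  map_smul' r u := by
    ext
    simp [constMat_apply, Matrix.sum_apply, Finset.smul_sum, smul_comm r]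

theorem braidMat_apply (u : Matrix (Fin 4) (Fin 4) (SU q)) (n k : Fin 4) :
    braidMat q u n k = ∑ c, ∑ d, braid q c d n k • u c d := by
  simp [braidMat, constMat_apply, Matrix.sum_apply]

variable {q}

theorem rowExt_tens (x : SU q) (c d : Fin 4) : rowExt q x (tens c d) = rowTwo q c d x := by
  simp [rowExt, tens, Matrix.single_apply, ite_and, ite_smul]

theorem constMat_tens (x : SU q) (c d : Fin 4) : constMat q x (tens c d) = Matrix.single c d x := by
  ext
  simp [constMat_apply, tens, Matrix.single_apply, ite_smul]

theorem braidMat_single (x : SU q) (c d : Fin 4) :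
    braidMat q (Matrix.single c d x) = constMat q x (braid q c d) := by
  ext
  simp [braidMat_apply, constMat_apply, Matrix.single_apply, ite_and]

theorem rowTwo_apply (c d n k : Fin 4) (x : SU q) :
    rowTwo q c d x n k = opf q c n (opf q d k x) := by
  simp [rowTwo, rowOne, Matrix.sum_apply, Matrix.single_apply, ite_and]

theorem IsDoublet.rowOne {e e' : SU q} (h : IsDoublet q e e') (k : Fin 4) :
    (rowOne q 0 k e = Matrix.single 0 k e + Matrix.single 3 k e' ∧
    rowOne q 1 k e = qC q • Matrix.single 1 k e + qDiff q • Matrix.single 2 k e' +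
      qC q • Matrix.single 3 k e ∧
    rowOne q 2 k e = Matrix.single 2 k e ∧
    rowOne q 3 k e = (qC q)⁻¹ • Matrix.single 3 k e) ∧
    rowOne q 0 k e' = Matrix.single 0 k e' ∧
    rowOne q 1 k e' = qDiff q • Matrix.single 0 k e + (qC q)⁻¹ • Matrix.single 1 k e' -
      (qC q)⁻¹ • Matrix.single 3 k e' ∧
    rowOne q 2 k e' = Matrix.single 2 k e' + Matrix.single 3 k e ∧
    rowOne q 3 k e' = qC q • Matrix.single 3 k e' := by
  have hn (x : SU q) : Matrix.single (3 : Fin 4) k (-x) = -Matrix.single 3 k x := by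
    rw [← neg_one_smul ℂ x, ← Matrix.smul_single, neg_one_smul]
  simp [QSphere.rowOne, Fin.sum_univ_four, h.opf_fst, h.opf_snd, Matrix.smul_single,
    sub_eq_add_neg, add_assoc]
  exact hn _

theorem IsDoublet.rowTwo {e e' : SU q} (h : IsDoublet q e e') (c : Fin 4) :
    (rowTwo q c 0 e = QSphere.rowOne q c 0 e + QSphere.rowOne q c 3 e' ∧
    rowTwo q c 1 e = qC q • QSphere.rowOne q c 1 e + qDiff q • QSphere.rowOne q c 2 e' +
      qC q • QSphere.rowOne q c 3 e ∧
    rowTwo q c 2 e = QSphere.rowOne q c 2 e ∧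
    rowTwo q c 3 e = (qC q)⁻¹ • QSphere.rowOne q c 3 e) ∧
    rowTwo q c 0 e' = QSphere.rowOne q c 0 e' ∧
    rowTwo q c 1 e' = qDiff q • QSphere.rowOne q c 0 e + (qC q)⁻¹ • QSphere.rowOne q c 1 e' -
      (qC q)⁻¹ • QSphere.rowOne q c 3 e' ∧
    rowTwo q c 2 e' = QSphere.rowOne q c 2 e' + QSphere.rowOne q c 3 e ∧
    rowTwo q c 3 e' = qC q • QSphere.rowOne q c 3 e' := by
  simp [QSphere.rowTwo, Fin.sum_univ_four, h.opf_fst, h.opf_snd, sub_eq_add_neg, add_assoc]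

-- On a doublet every `f_{ab}` yields a combination of `e` and `e'`, so each of the sixteen cases
-- compares coefficients that are rational in `q`.
set_option maxHeartbeats 4000000 in
theorem IsDoublet.rowExt_braid_fst {e e' : SU q} (h : IsDoublet q e e') (a b : Fin 4) :
    rowExt q e (braid q a b) = braidMat q (QSphere.rowTwo q a b e) := by
  have hq := qC_ne_zero q
  fin_cases a <;> fin_cases b <;>
    simp only [Fin.zero_eta, Fin.mk_one, Fin.reduceFinMk, braid_apply, h.rowTwo, h.rowOne, map_add,
      map_sub, map_smul, rowExt_tens, constMat_tens, braidMat_single]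
  all_goals try simp only [qDiff]
  all_goals match_scalars <;> field_simp <;> try ring

set_option maxHeartbeats 4000000 in
theorem IsDoublet.rowExt_braid_snd {e e' : SU q} (h : IsDoublet q e e') (a b : Fin 4) :
    rowExt q e' (braid q a b) = braidMat q (QSphere.rowTwo q a b e') := by
  have hq := qC_ne_zero q
  fin_cases a <;> fin_cases b <;>
    simp only [Fin.zero_eta, Fin.mk_one, Fin.reduceFinMk, braid_apply, h.rowTwo, h.rowOne, map_add,
      map_sub, map_smul, rowExt_tens, constMat_tens, braidMat_single]
  all_goals try simp only [qDiff]
  all_goals match_scalars <;> field_simp <;> try ring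

theorem sum_rotate {α β M : Type*} [Fintype α] [Fintype β] [AddCommMonoid M] (G : α → α → β → M) :
    ∑ a, ∑ b, ∑ c, G a b c = ∑ c, ∑ a, ∑ b, G a b c :=
  (Finset.sum_congr rfl fun _ _ => Finset.sum_comm).trans Finset.sum_comm

theorem sum_sum_comm {ι M : Type*} [Fintype ι] [AddCommMonoid M] (F : ι → ι → ι → ι → M) :
    ∑ a, ∑ b, ∑ c, ∑ d, F a b c d = ∑ c, ∑ d, ∑ a, ∑ b, F a b c d := by
  rw [sum_rotate]
  exact Finset.sum_congr rfl fun c _ => sum_rotate _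

theorem opf_opf_mul (a b n k : Fin 4) (x y : SU q) :
    opf q a n (opf q b k (x * y)) =
      ∑ c, ∑ d, opf q a c (opf q b d x) * opf q c n (opf q d k y) := by
  simp only [opf_mul, map_sum]
  exact Finset.sum_comm

/-- The braiding is compatible with the right multiplication of 1-forms. -/
theorem braid_opf (x : SU q) (a b n k : Fin 4) :
    ∑ c, ∑ d, braid q a b c d • opf q c n (opf q d k x) =
      ∑ c, ∑ d, braid q c d n k • opf q a c (opf q b d x) := by
  have key {y : SU q} (hy : ∀ a b, rowExt q y (braid q a b) = braidMat q (rowTwo q a b y))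
      (a b n k : Fin 4) : ∑ c, ∑ d, braid q a b c d • opf q c n (opf q d k y) =
      ∑ c, ∑ d, braid q c d n k • opf q a c (opf q b d y) := by
    simpa [rowExt, braidMat_apply, rowTwo_apply, Matrix.sum_apply] using
      congrFun (congrFun (hy a b) n) k
  induction x using SU.induction q generalizing a b n k with
  | hgen g =>
    cases g
    · exact key (isDoublet_a q).rowExt_braid_fst a b n k
    · exact key (isDoublet_c q).rowExt_braid_snd a b n k
    · exact key (isDoublet_c q).rowExt_braid_fst a b n k
    -- The second vector of this doublet is `-q c^*`; the scalar has to be cancelled.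
    · have h := key (isDoublet_a q).rowExt_braid_snd a b n k
      simp only [map_neg, map_smul, smul_neg, smul_comm _ (qC q), Finset.sum_neg_distrib,
        ← Finset.smul_sum, neg_inj] at h
      exact smul_right_injective _ (qC_ne_zero q) h
  | halg r => simp [opf_algebraMap, apply_ite]
  | hadd x y hx hy => simp only [map_add, smul_add, Finset.sum_add_distrib, hx, hy]
  | hmul x y hx hy =>
    simp only [opf_opf_mul, Finset.smul_sum]
    -- The coproduct of `f` splits the action on `x y`; the braiding is then moved past `x` by `hx`
    -- and past `y` by `hy`.
    calc ∑ c, ∑ d, ∑ e, ∑ f, braid q a b c d • (opf q c e (opf q d f x) * opf q e n (opf q f k y))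
        = ∑ e, ∑ f, (∑ c, ∑ d, braid q a b c d • opf q c e (opf q d f x)) *
            opf q e n (opf q f k y) := by
          simp only [Finset.sum_mul, smul_mul_assoc]
          exact sum_sum_comm _
      _ = ∑ c, ∑ d, opf q a c (opf q b d x) *
            ∑ e, ∑ f, braid q c d e f • opf q e n (opf q f k y) := by
          simp only [hx, Finset.sum_mul, Finset.mul_sum, smul_mul_assoc, mul_smul_comm]
          exact sum_sum_comm _
      _ = _ := by
          simp only [hy, Finset.mul_sum, mul_smul_comm]
          exact sum_sum_comm _

end braiding

/-! ### Representations of the forms induced from the invariant forms -/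

section representation

variable (q : Set.Ioo (0 : ℝ) 1)

/-- The composition `f_{w₁b₁} f_{w₂b₂} ⋯`. -/
def opfProd : (k : ℕ) → (w b : Fin k → Fin 4) → Module.End ℂ (SU q)
  | 0, _, _ => 1
  | k + 1, w, b => opf q (w 0) (b 0) * opfProd k (Fin.tail w) (Fin.tail b)

/-- The action of `x` on tensors by right multiplication, with coefficients evaluated by `ℓ`. -/
def tensorAct (k : ℕ) (x : SU q) (l : SU q →ₗ[ℂ] ℂ) : Module.End ℂ (InvTensor k) where
  toFun v b := ∑ w, v w * l (opfProd q k w b x)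
  map_add' u v := by ext; simp [add_mul, Finset.sum_add_distrib]
  map_smul' r v := by ext; simp [Finset.mul_sum, mul_assoc]

variable {q}

theorem tensorAct_apply (k : ℕ) (x : SU q) (l : SU q →ₗ[ℂ] ℂ) (v : InvTensor k)
    (b : Fin k → Fin 4) : tensorAct q k x l v b = ∑ w, v w * l (opfProd q k w b x) :=
  rfl

theorem sum_fin_succ {k : ℕ} {M : Type*} [AddCommMonoid M] (F : (Fin (k + 1) → Fin 4) → M) :
    ∑ w, F w = ∑ a, ∑ w, F (Fin.cons a w) := by
  rw [← Fintype.sum_prod_type']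
  exact (Fintype.sum_equiv (Fin.consEquiv fun _ => Fin 4) _ _ fun _ => rfl).symm

theorem tensorAct_succ (k : ℕ) (x : SU q) (l : SU q →ₗ[ℂ] ℂ) (v : InvTensor (k + 1))
    (b : Fin (k + 1) → Fin 4) :
    tensorAct q (k + 1) x l v b =
      ∑ a, tensorAct q k x (l ∘ₗ opf q a (b 0)) (fun u => v (Fin.cons a u)) (Fin.tail b) := by
  simp [tensorAct_apply, sum_fin_succ, opfProd]

/-- By `tensorAct_succ` the first factor only replaces `l` by the functionals `l ∘ f_{ab}` in the
action on the tail. This is why commutation is required for all functionals at once. -/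
theorem tensorAct_onTail {k : ℕ} {X : Module.End ℂ (InvTensor k)} {x : SU q}
    (h : ∀ l, Commute X (tensorAct q k x l)) (l : SU q →ₗ[ℂ] ℂ) :
    Commute (onTail X) (tensorAct q (k + 1) x l) := by
  refine LinearMap.ext fun v => funext fun b => ?_
  have h' (l v) : X (tensorAct q k x l v) = tensorAct q k x l (X v) := LinearMap.congr_fun (h l) v
  simp only [Module.End.mul_apply, tensorAct_succ]
  change X (fun u => tensorAct q (k + 1) x l v (Fin.cons (b 0) u)) (Fin.tail b) = _
  simp only [tensorAct_succ, Fin.cons_zero, Fin.tail_cons]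
  have : (fun u => ∑ a, tensorAct q k x (l ∘ₗ opf q a (b 0)) (fun u => v (Fin.cons a u)) u) =
      ∑ a, tensorAct q k x (l ∘ₗ opf q a (b 0)) (fun u => v (Fin.cons a u)) := by
    ext; simp
  rw [this, map_sum, Finset.sum_apply]
  simp only [h']
  rfl

theorem sum_mul_sum_swap {α β : Type*} [Fintype α] [Fintype β] (B : α → α → ℂ)
    (V : α → α → β → ℂ) (G : α → α → β → α → α → ℂ) :
    ∑ a, ∑ b, B a b * ∑ c, ∑ d, ∑ u, V c d u * G c d u a b =
      ∑ c, ∑ d, ∑ u, V c d u * ∑ a, ∑ b, B a b * G c d u a b := by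
  simp only [Finset.mul_sum]
  rw [sum_sum_comm]
  refine Finset.sum_congr rfl fun c _ => Finset.sum_congr rfl fun d _ => ?_
  rw [sum_rotate]
  simp only [mul_left_comm]

theorem sum_sum_mul_swap {α β : Type*} [Fintype α] [Fintype β] (B : α → α → α → α → ℂ)
    (V : α → α → β → ℂ) (G : α → α → β → ℂ) :
    ∑ c, ∑ d, ∑ u, (∑ a, ∑ b, B a b c d * V a b u) * G c d u =
      ∑ a, ∑ b, ∑ u, V a b u * ∑ c, ∑ d, B a b c d * G c d u := by
  simp only [Finset.mul_sum, Finset.sum_mul]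
  have h (c d : α) : ∑ u, ∑ a, ∑ b, B a b c d * V a b u * G c d u =
      ∑ a, ∑ b, ∑ u, B a b c d * V a b u * G c d u := (sum_rotate _).symm
  simp only [h]
  rw [sum_sum_comm]
  refine Finset.sum_congr rfl fun c _ => Finset.sum_congr rfl fun d _ => ?_
  rw [sum_rotate]
  simp only [mul_assoc, mul_left_comm]

theorem tensorAct_braidHead (k : ℕ) (x : SU q) (l : SU q →ₗ[ℂ] ℂ) :
    Commute (braidHead q k) (tensorAct q (k + 2) x l) := by
  refine LinearMap.ext fun v => funext fun w => ?_
  have hT (a b : Fin 4) (u : Fin k → Fin 4) :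
      tensorAct q (k + 2) x l v (Fin.cons a (Fin.cons b u)) = ∑ c, ∑ d, ∑ s,
        v (Fin.cons c (Fin.cons d s)) * l (opf q c a (opf q d b (opfProd q k s u x))) := by
    rw [tensorAct_apply, sum_fin_succ]
    refine Finset.sum_congr rfl fun c _ => ?_
    rw [sum_fin_succ]
    rfl
  have hB : tensorAct q (k + 2) x l (braidHead q k v) w = ∑ c, ∑ d, ∑ s,
      (∑ a, ∑ b, braid q a b c d * v (Fin.cons a (Fin.cons b s))) *
        l (opf q c (w 0) (opf q d (w 1) (opfProd q k s (Fin.tail (Fin.tail w)) x))) := by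
    rw [tensorAct_apply, sum_fin_succ]
    refine Finset.sum_congr rfl fun c _ => ?_
    rw [sum_fin_succ]
    rfl
  have hR (c d : Fin 4) (y : SU q) : ∑ a, ∑ b, braid q a b (w 0) (w 1) *
      l (opf q c a (opf q d b y)) = ∑ a, ∑ b, braid q c d a b *
      l (opf q a (w 0) (opf q b (w 1) y)) := by
    simpa only [map_sum, map_smul, smul_eq_mul] using congrArg l (braid_opf y c d (w 0) (w 1)).symm
  rw [Module.End.mul_apply, Module.End.mul_apply]
  refine Eq.trans ?_ (hB.trans (sum_sum_mul_swap (fun a b c d => braid q a b c d)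
    (fun a b s => v (Fin.cons a (Fin.cons b s))) (fun c d s =>
      l (opf q c (w 0) (opf q d (w 1) (opfProd q k s (Fin.tail (Fin.tail w)) x)))))).symm
  change ∑ a, ∑ b, braid q a b (w 0) (w 1) *
    tensorAct q (k + 2) x l v (Fin.cons a (Fin.cons b (Fin.tail (Fin.tail w)))) = _
  simp only [hT]
  rw [sum_mul_sum_swap (fun a b => braid q a b (w 0) (w 1))
    (fun c d u => v (Fin.cons c (Fin.cons d u)))]
  simp only [hR]

theorem tensorAct_cosetSum (k : ℕ) (x : SU q) (l : SU q →ₗ[ℂ] ℂ) :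
    Commute (cosetSum q k) (tensorAct q (k + 1) x l) := by
  induction k generalizing l with
  | zero => exact Commute.one_left _
  | succ k ih =>
    exact (Commute.one_left _).sub_left
      ((tensorAct_onTail ih l).mul_left (tensorAct_braidHead k x l))

/-- Consequently the kernel of the antisymmetrizer is stable under right multiplication by
functions. -/
theorem tensorAct_antisymmetrizer (k : ℕ) (x : SU q) (l : SU q →ₗ[ℂ] ℂ) :
    Commute (antisymmetrizer q k) (tensorAct q k x l) := by
  induction k generalizing l with
  | zero => exact Commute.one_left _
  | succ k ih => exact (tensorAct_cosetSum k x l).mul_left (tensorAct_onTail ih l)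

variable (q) in
/-- The operator on `J`-tuples through which `ω_a` acts when `ω_b` acts on `J`-tuples of scalars
by `L b`. -/
def omegaOp {J : Type} [Fintype J] (L : Fin 4 → Matrix J J ℂ) (a : Fin 4) :
    Module.End ℂ (J → SU q) where
  toFun m j := ∑ b, ∑ i, L b j i • opf q a b (m i)
  map_add' m m' := by ext; simp [Finset.sum_add_distrib]
  map_smul' r m := by ext; simp [Finset.smul_sum, smul_comm r]

theorem omegaOp_apply {J : Type} [Fintype J] (L : Fin 4 → Matrix J J ℂ) (a : Fin 4)
    (m : J → SU q) (j : J) : omegaOp q L a m j = ∑ b, ∑ i, L b j i • opf q a b (m i) :=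
  rfl

theorem omegaOp_prod {J : Type} [Fintype J] [DecidableEq J] (L : Fin 4 → Matrix J J ℂ) (k : ℕ)
    (w : Fin k → Fin 4) (m : J → SU q) (j : J) :
    (List.ofFn fun i => omegaOp q L (w i)).prod m j =
      ∑ b, ∑ i, (List.ofFn fun s => L (b s)).prod j i • opfProd q k w b (m i) := by
  induction k generalizing m j with
  | zero => simp [opfProd, Matrix.one_apply]
  | succ k ih =>
    rw [List.ofFn_succ, List.prod_cons, Module.End.mul_apply, omegaOp_apply, sum_fin_succ]
    refine Finset.sum_congr rfl fun a _ => ?_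
    have ih' := ih (Fin.tail w) m
    simp only [Fin.tail] at ih'
    simp only [ih', List.ofFn_succ, List.prod_cons, Matrix.mul_apply, opfProd, Fin.cons_zero,
      Fin.cons_succ, Fin.tail_cons, map_sum, map_smul, Module.End.mul_apply, Finset.smul_sum,
      Finset.sum_smul, smul_smul]
    rw [Finset.sum_comm]
    refine Finset.sum_congr rfl fun b _ => Finset.sum_comm

/-- Letting a tensor of forms act on a tuple `m` means moving it past the functions `m i`. After a
functional is applied, `v` has turned into `tensorAct q k (m i) l v`, which lies in the same kernel,
so `hL` kills it. Functionals separate the elements of `A(SU_q(2))`. -/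
theorem sum_omegaOp_prod_eq_zero {J : Type} [Fintype J] [DecidableEq J] (L : Fin 4 → Matrix J J ℂ)
    (k : ℕ) (hL : ∀ v : InvTensor k, antisymmetrizer q k v = 0 →
      ∑ w, v w • (List.ofFn fun s => L (w s)).prod = 0)
    (v : InvTensor k) (hv : antisymmetrizer q k v = 0) :
    ∑ w, v w • (List.ofFn fun i => omegaOp q L (w i)).prod = 0 := by
  refine LinearMap.ext fun m => funext fun j => ?_
  rw [LinearMap.zero_apply, Pi.zero_apply, ← Module.forall_dual_apply_eq_zero_iff ℂ]
  intro l
  have h (i : J) := congrFun (congrFun (hL (tensorAct q k (m i) l v) (by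
    rw [← Module.End.mul_apply, (tensorAct_antisymmetrizer k (m i) l).eq, Module.End.mul_apply, hv,
      map_zero])) j) i
  simp only [Matrix.sum_apply, Matrix.smul_apply, Matrix.zero_apply, tensorAct_apply] at h
  simp only [LinearMap.sum_apply, Finset.sum_apply, LinearMap.smul_apply, Pi.smul_apply,
    omegaOp_prod, map_sum, map_smul, Finset.smul_sum]
  rw [Finset.sum_congr rfl fun w _ => Finset.sum_comm, Finset.sum_comm,
    Finset.sum_congr rfl fun b _ => Finset.sum_comm]
  refine Finset.sum_eq_zero fun i _ => ?_
  rw [← h i]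
  refine Finset.sum_congr rfl fun b _ => ?_
  rw [smul_eq_mul, Finset.sum_mul]
  refine Finset.sum_congr rfl fun w _ => ?_
  simp only [smul_eq_mul]
  ring

variable (q) in
/-- The representation of the forms determined by a representation of the left invariant forms. -/
def formsRep {J : Type} [Fintype J] [DecidableEq J] (L : Fin 4 → Matrix J J ℂ)
    (hL : ∀ (k : ℕ) (v : InvTensor k), antisymmetrizer q k v = 0 →
      ∑ w, v w • (List.ofFn fun s => L (w s)).prod = 0) :
    Forms q →ₐ[ℂ] Module.End ℂ (J → SU q) :=
  RingQuot.liftAlgHom ℂ ⟨FreeAlgebra.lift ℂ (Sum.elim (Algebra.lmul ℂ (SU q) · |>.compLeft J)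
    (omegaOp q L)), by
      intro x y hxy
      cases hxy with
      | add x y => ext; simp
      | mul x y => ext; simp [mul_assoc]
      | scalar r => ext; simp [Algebra.smul_def]
      | bimodule a x =>
        refine LinearMap.ext fun m => funext fun j => ?_
        simp only [map_mul, map_sum, FreeAlgebra.lift_ι_apply, Sum.elim_inl, Sum.elim_inr,
          Module.End.mul_apply, LinearMap.sum_apply, Finset.sum_apply]
        change ∑ b, ∑ i, L b j i • opf q a b (x * m i) =
          ∑ b, opf q a b x * ∑ c, ∑ i, L c j i • opf q b c (m i)
        simp only [opf_mul, Finset.smul_sum, Finset.mul_sum, mul_smul_comm]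
        rw [Finset.sum_congr rfl fun b _ => Finset.sum_comm, Finset.sum_comm]
      | wedge k v hv =>
        have h := sum_omegaOp_prod_eq_zero L k (hL k) v hv
        simpa [List.map_ofFn, map_list_prod, Function.comp_def] using h⟩

theorem formsRep_fn {J : Type} [Fintype J] [DecidableEq J] (L : Fin 4 → Matrix J J ℂ)
    (hL : ∀ (k : ℕ) (v : InvTensor k), antisymmetrizer q k v = 0 →
      ∑ w, v w • (List.ofFn fun s => L (w s)).prod = 0) (x : SU q) (m : J → SU q) (j : J) :
    formsRep q L hL (fn q x) m j = x * m j := by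
  change formsRep q L hL (mkForms q _) m j = _
  unfold formsRep mkForms
  erw [RingQuot.liftAlgHom_mkAlgHom_apply]
  simp

theorem formsRep_omega {J : Type} [Fintype J] [DecidableEq J] (L : Fin 4 → Matrix J J ℂ)
    (hL : ∀ (k : ℕ) (v : InvTensor k), antisymmetrizer q k v = 0 →
      ∑ w, v w • (List.ofFn fun s => L (w s)).prod = 0) (a : Fin 4) :
    formsRep q L hL (omega q a) = omegaOp q L a := by
  unfold formsRep omega mkForms
  erw [RingQuot.liftAlgHom_mkAlgHom_apply]
  simp

end representation

/-! ### Freeness of the volume form -/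

section volume

variable (q : Set.Ioo (0 : ℝ) 1)

/-- The coefficients of the invariant 3-tensors in one row of the third antisymmetrizer. -/
def volCoeff : Fin 4 → Matrix (Fin 4) (Fin 4) ℂ :=
  ![tens 2 3 - tens 3 2, ((qC q ^ 2)⁻¹ - qC q ^ 2) • (tens 1 3 - tens 3 1), tens 3 0 - tens 0 3,
    tens 0 2 - tens 2 0 + ((qC q ^ 2)⁻¹ - qC q ^ 2) • tens 1 1 + qDiff q ^ 2 • tens 1 3]

/-- The left multiplication by `ω_b` on `ℂ ⊕ V ⊕ V^* ⊕ ℂ`, a quotient of the left invariant forms;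
`V` is spanned by the `ω_a`. -/
def volMat (b : Fin 4) : Matrix (Option (Fin 4) ⊕ Option (Fin 4)) (Option (Fin 4) ⊕ Option (Fin 4)) ℂ
  | .inl (some c), .inl none => if b = c then 1 else 0
  | .inr (some i), .inl (some d) => volCoeff q i b d
  | .inr none, .inr (some i) => if b = i then 1 else 0
  | _, _ => 0

/-- The degree of the basis elements of `ℂ ⊕ V ⊕ V^* ⊕ ℂ`. -/
def volDeg : Option (Fin 4) ⊕ Option (Fin 4) → ℕ
  | .inl none => 0
  | .inl (some _) => 1
  | .inr (some _) => 2
  | .inr none => 3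

theorem volMat_eq_zero {b : Fin 4} {i j : Option (Fin 4) ⊕ Option (Fin 4)}
    (h : volDeg i ≠ volDeg j + 1) : volMat q b i j = 0 := by
  rcases i with (_ | i) | (_ | i) <;> rcases j with (_ | j) | (_ | j) <;> simp [volDeg] at h <;> rfl

theorem volMat_prod_eq_zero (l : List (Fin 4)) {i j : Option (Fin 4) ⊕ Option (Fin 4)}
    (h : volDeg i ≠ volDeg j + l.length) : (l.map (volMat q)).prod i j = 0 := by
  induction l generalizing i with
  | nil =>
    have : i ≠ j := fun hij => h (by simp [hij])
    simp [this]
  | cons b l ih =>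
    rw [List.map_cons, List.prod_cons, Matrix.mul_apply]
    refine Finset.sum_eq_zero fun s _ => ?_
    by_cases hs : volDeg s = volDeg j + l.length
    · rw [volMat_eq_zero, zero_mul]
      simp only [List.length_cons] at h
      omega
    · rw [ih hs, mul_zero]

theorem volMat_mul_covec (b c i : Fin 4) :
    (volMat q b * volMat q c) (.inr (some i)) (.inl none) = volCoeff q i b c := by
  simp [Matrix.mul_apply, Fintype.sum_sum_type, Fintype.sum_option, volMat]

theorem volMat_mul_top (b c d : Fin 4) :
    (volMat q b * volMat q c) (.inr none) (.inl (some d)) = volCoeff q b c d := by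
  simp [Matrix.mul_apply, Fintype.sum_sum_type, Fintype.sum_option, volMat]

theorem volMat_mul_mul (b c d : Fin 4) :
    (volMat q b * (volMat q c * volMat q d)) (.inr none) (.inl none) = volCoeff q b c d := by
  rw [Matrix.mul_apply]
  simp [Fintype.sum_sum_type, Fintype.sum_option, volMat_mul_covec, volMat]

theorem sum_fin_two (F : (Fin 2 → Fin 4) → ℂ) : ∑ w, F w = ∑ a, ∑ b, F ![a, b] := by
  simp only [sum_fin_succ, Fintype.sum_unique]
  rfl

theorem sum_fin_three (F : (Fin 3 → Fin 4) → ℂ) : ∑ w, F w = ∑ a, ∑ b, ∑ c, F ![a, b, c] := by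
  simp only [sum_fin_succ, Fintype.sum_unique]
  rfl

theorem antisymmetrizer_two_apply (v : InvTensor 2) (n k : Fin 4) :
    antisymmetrizer q 2 v ![n, k] = v ![n, k] - ∑ a, ∑ b, braid q a b n k * v ![a, b] := by
  rfl

theorem antisymmetrizer_three_apply (v : InvTensor 3) (n k m : Fin 4) :
    antisymmetrizer q 3 v ![n, k, m] = antisymmetrizer q 2 (fun u => v (Fin.cons n u)) ![k, m] -
    (∑ a, ∑ b, braid q a b n k * antisymmetrizer q 2 (fun u => v (Fin.cons a u)) ![b, m] -
    ∑ c, ∑ d, braid q c d k m *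
      ∑ a, ∑ b, braid q a b n c * antisymmetrizer q 2 (fun u => v (Fin.cons a u)) ![b, d]) := by
  rfl

theorem braid_row (X : Fin 4 → Fin 4 → ℂ) :
    ∑ a, ∑ b, braid q a b 0 1 * X a b = (qC q ^ 2)⁻¹ * X 1 0 ∧
    ∑ a, ∑ b, braid q a b 0 2 * X a b =
      X 2 0 + (qC q ^ 2 - (qC q ^ 2)⁻¹) * X 1 1 - qDiff q ^ 2 * X 1 3 ∧
    ∑ a, ∑ b, braid q a b 0 3 * X a b = (1 + qC q ^ 2) * X 0 1 + (1 - qC q ^ 2) * X 0 3 -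
      (1 + (qC q ^ 2)⁻¹) * X 1 0 + qC q ^ 2 * X 3 0 ∧
    ∑ a, ∑ b, braid q a b 1 1 * X a b = X 1 1 ∧
    ∑ a, ∑ b, braid q a b 1 2 * X a b = (1 - qC q ^ 2) * X 1 2 + X 2 1 ∧
    ∑ a, ∑ b, braid q a b 1 3 * X a b = X 2 0 - X 0 2 +
      (qC q ^ 2 - (qC q ^ 2)⁻¹) * X 1 1 - qDiff q ^ 2 * X 1 3 + X 3 1 ∧
    ∑ a, ∑ b, braid q a b 2 3 * X a b = (1 + qC q ^ 2) * X 1 2 -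
      (1 + (qC q ^ 2)⁻¹) * X 2 1 + (1 - (qC q ^ 2)⁻¹) * X 2 3 + (qC q ^ 2)⁻¹ * X 3 2 ∧
    ∑ a, ∑ b, braid q a b 3 0 * X a b = X 0 3 ∧
    ∑ a, ∑ b, braid q a b 3 1 * X a b = X 1 3 ∧
    ∑ a, ∑ b, braid q a b 3 2 * X a b = X 2 3 ∧
    ∑ a, ∑ b, braid q a b 3 3 * X a b = X 3 3 := by
  refine ⟨?_, ?_, ?_, ?_, ?_, ?_, ?_, ?_, ?_, ?_, ?_⟩ <;>
    simp [Fin.sum_univ_four, braid_apply, tens] <;> ring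

theorem volCoeff_pairing (X : Fin 4 → Fin 4 → ℂ) :
    ∑ a, ∑ b, X a b * volCoeff q 0 a b = X 2 3 - X 3 2 ∧
    ∑ a, ∑ b, X a b * volCoeff q 1 a b = ((qC q ^ 2)⁻¹ - qC q ^ 2) * (X 1 3 - X 3 1) ∧
    ∑ a, ∑ b, X a b * volCoeff q 2 a b = X 3 0 - X 0 3 ∧
    ∑ a, ∑ b, X a b * volCoeff q 3 a b = X 0 2 - X 2 0 +
      ((qC q ^ 2)⁻¹ - qC q ^ 2) * X 1 1 + qDiff q ^ 2 * X 1 3 := by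
  refine ⟨?_, ?_, ?_, ?_⟩ <;>
    simp [Fin.sum_univ_four, volCoeff, tens] <;> ring

theorem volCoeff_pairing' (X : Fin 4 → Fin 4 → ℂ) :
    ∑ a, ∑ b, X a b * volCoeff q a b 0 = X 2 3 - X 3 2 ∧
    ∑ a, ∑ b, X a b * volCoeff q a b 1 = ((qC q ^ 2)⁻¹ - qC q ^ 2) * (X 3 1 - X 1 3) ∧
    ∑ a, ∑ b, X a b * volCoeff q a b 2 = X 3 0 - X 0 3 ∧
    ∑ a, ∑ b, X a b * volCoeff q a b 3 = X 0 2 - X 2 0 +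
      ((qC q ^ 2)⁻¹ - qC q ^ 2) * X 1 1 + qDiff q ^ 2 * X 3 1 := by
  refine ⟨?_, ?_, ?_, ?_⟩ <;>
    simp [Fin.sum_univ_four, volCoeff, tens] <;> ring

variable {q}

/-- These are four of the sixteen equations `v = σ v`; the pairings with `volCoeff` involve no other
combinations of the entries. -/
theorem symm_of_antisymmetrizer_two {v : InvTensor 2} (hv : antisymmetrizer q 2 v = 0) :
    v ![3, 2] = v ![2, 3] ∧ v ![3, 1] = v ![1, 3] ∧ v ![3, 0] = v ![0, 3] ∧
    v ![0, 2] - v ![2, 0] + ((qC q ^ 2)⁻¹ - qC q ^ 2) * v ![1, 1] +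
      qDiff q ^ 2 * v ![1, 3] = 0 := by
  have h (n k : Fin 4) : v ![n, k] - ∑ a, ∑ b, braid q a b n k * v ![a, b] = 0 := by
    rw [← antisymmetrizer_two_apply, hv]; rfl
  have h1 := h 3 2
  have h2 := h 3 1
  have h3 := h 3 0
  have h4 := h 0 2
  simp only [braid_row q fun a b => v ![a, b]] at h1 h2 h3 h4
  refine ⟨by linear_combination h1, by linear_combination h2, by linear_combination h3,
    by linear_combination h4⟩

theorem volCoeff_two {v : InvTensor 2} (hv : antisymmetrizer q 2 v = 0) (d : Fin 4) :
    ∑ a, ∑ b, v ![a, b] * volCoeff q d a b = 0 ∧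
      ∑ a, ∑ b, v ![a, b] * volCoeff q a b d = 0 := by
  obtain ⟨h1, h2, h3, h4⟩ := symm_of_antisymmetrizer_two hv
  fin_cases d <;>
    simp only [Fin.zero_eta, Fin.mk_one, Fin.reduceFinMk,
      volCoeff_pairing q fun a b => v ![a, b], volCoeff_pairing' q fun a b => v ![a, b], h1, h2, h3,
      h4, sub_self, mul_zero, and_self]

theorem volCoeff_three (v : InvTensor 3) :
    ∑ a, ∑ b, ∑ c, v ![a, b, c] * volCoeff q a b c = antisymmetrizer q 3 v ![0, 2, 3] := by
  have hq := qC_ne_zero q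
  have hc (n a b : Fin 4) : v (Fin.cons n ![a, b]) = v ![n, a, b] := rfl
  rw [antisymmetrizer_three_apply]
  simp only [antisymmetrizer_two_apply, hc]
  simp only [Fin.sum_univ_four (fun a => ∑ b, ∑ c, v ![a, b, c] * volCoeff q a b c),
    volCoeff_pairing q fun a b => v ![_, a, b], braid_row q fun _ _ => _]
  field_simp
  simp only [qDiff]
  field_simp
  ring

/-- Each `volMat` raises the degree by one, so only `k ≤ 3` matters. For `k ≤ 1` the antisymmetrizer
is the identity. For `k = 2` the trilinear form `volCoeff` is contracted with `v` in its first two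
or its last two slots (`volCoeff_two`). For `k = 3` the contraction is an entry of the
antisymmetrized tensor (`volCoeff_three`). -/
theorem volMat_annihilates (k : ℕ) (v : InvTensor k) (hv : antisymmetrizer q k v = 0) :
    ∑ w, v w • (List.ofFn fun s => volMat q (w s)).prod = 0 := by
  ext i j
  rw [Matrix.sum_apply]
  simp only [Matrix.smul_apply, smul_eq_mul, Matrix.zero_apply]
  by_cases hd : volDeg i = volDeg j + k
  swap
  · refine Finset.sum_eq_zero fun w _ => ?_
    have := volMat_prod_eq_zero q (List.ofFn w) (i := i) (j := j) (by simpa using hd)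
    rw [List.map_ofFn] at this
    rw [show (List.ofFn fun s => volMat q (w s)) = List.ofFn (volMat q ∘ w) from rfl, this, mul_zero]
  obtain _ | _ | _ | _ | k := k
  · have : v = 0 := hv
    simp [this]
  · have : v = 0 := by
      have h : antisymmetrizer q 1 v = v := by
        ext w
        change v (Fin.cons (w 0) (Fin.tail w)) = v w
        rw [Fin.cons_self_tail]
      rw [← h, hv]
    simp [this]
  · rw [sum_fin_two]
    simp only [List.ofFn_succ, List.ofFn_zero, List.prod_cons, List.prod_nil, mul_one,
      Matrix.cons_val_zero, Matrix.cons_val_succ]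
    rcases i with (_ | i) | (_ | i) <;> rcases j with (_ | j) | (_ | j) <;> simp [volDeg] at hd
    · simpa only [volMat_mul_top] using (volCoeff_two hv j).2
    · simpa only [volMat_mul_covec] using (volCoeff_two hv i).1
  · rw [sum_fin_three]
    simp only [List.ofFn_succ, List.ofFn_zero, List.prod_cons, List.prod_nil, mul_one,
      Matrix.cons_val_zero, Matrix.cons_val_succ]
    rcases i with (_ | i) | (_ | i) <;> rcases j with (_ | j) | (_ | j) <;> simp [volDeg] at hd
    simp only [volMat_mul_mul, volCoeff_three, hv]
    rfl
  · rcases i with (_ | i) | (_ | i) <;> rcases j with (_ | j) | (_ | j) <;> simp [volDeg] at hd <;>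
      omega

/-- The form `ω₋ ω₊ ω₀` is free over `A(SU_q(2))`. -/
theorem eq_zero_of_fn_mul_volume (x : SU q)
    (h : fn q x * (omega q 0 * (omega q 2 * omega q 3)) = 0) : x = 0 := by
  -- The form is applied to the constant function `1` in degree 0 and read off in degree 3. There
  -- `ω₋ω₊ω₀` contributes the coefficient `volCoeff q 0 2 3 = 1`, which leaves `x`.
  have h1 := congrArg (fun f => formsRep q (volMat q) volMat_annihilates f
    (Pi.single (.inl none) 1) (.inr none)) h
  have hone (a b : Fin 4) : opf q a b 1 = if a = b then 1 else 0 := by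
    simpa using opf_algebraMap q a b 1
  simp only [map_mul, map_zero, Module.End.mul_apply, formsRep_fn, formsRep_omega] at h1
  have e1 : omegaOp q (volMat q) 3 (Pi.single (.inl none) 1) = Pi.single (.inl (some 3)) 1 := by
    ext j
    rcases j with (_ | j) | (_ | j) <;>
      simp [omegaOp_apply, Fintype.sum_sum_type, Fintype.sum_option, volMat, Pi.single_apply, hone]
    exact if_congr eq_comm rfl rfl
  rw [e1] at h1
  simpa [omegaOp_apply, Fintype.sum_sum_type, Fintype.sum_option, volMat, Pi.single_apply, hone,
    volCoeff, tens, apply_ite, ite_smul] using h1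

end volume

/-! ### Calculus with `ω₋, ω₊, ω₀` -/

section forms

variable (q : Set.Ioo (0 : ℝ) 1)

theorem omega_mul_fn (a : Fin 4) (x : SU q) :
    omega q a * fn q x = ∑ b, fn q (opf q a b x) * omega q b := by
  have h := mkForms_rel q (FormRel.bimodule a x)
  simp only [map_mul, map_sum] at h
  exact h

/-- The second antisymmetrizer is `1 - σ`, so its kernel consists of the tensors fixed by `σ`. -/
theorem wedge_two (u : Matrix (Fin 4) (Fin 4) ℂ) (hu : ∑ a, ∑ b, u a b • braid q a b = u) :
    ∑ a, ∑ b, u a b • (omega q a * omega q b) = 0 := by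
  have hv : antisymmetrizer q 2 (fun w => u (w 0) (w 1)) = 0 := by
    ext w
    obtain ⟨n, k, rfl⟩ : ∃ n k, w = ![n, k] :=
      ⟨w 0, w 1, by ext i; fin_cases i <;> rfl⟩
    rw [antisymmetrizer_two_apply]
    have := congrFun (congrFun hu n) k
    simp only [Matrix.sum_apply, Matrix.smul_apply, smul_eq_mul] at this
    simp [← this, mul_comm]
  have h := mkForms_rel q (FormRel.wedge 2 _ hv)
  simp only [sum_fin_succ, Fintype.sum_unique, map_sum, map_smul, map_zero] at h
  rw [← h]
  refine Finset.sum_congr rfl fun a _ => Finset.sum_congr rfl fun b _ => ?_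
  simp [omega]

theorem omega_sq (a : Fin 4) (ha : braid q a a = tens a a) : omega q a * omega q a = 0 := by
  have h := wedge_two q (tens a a) (by simp [tens, Matrix.single_apply, ite_and, ite_smul, ha])
  simpa [tens, Matrix.single_apply, ite_and, ite_smul] using h

theorem omega_anticomm (a b : Fin 4)
    (h : braid q a b + braid q b a = tens a b + tens b a) :
    omega q b * omega q a = -(omega q a * omega q b) := by
  have h := wedge_two q (tens a b + tens b a) (by
    simp [tens, Matrix.single_apply, ite_and, ite_smul, add_smul, Finset.sum_add_distrib]
    simpa [tens] using h)
  simp [tens, Matrix.single_apply, ite_and, ite_smul, add_smul, Finset.sum_add_distrib] at h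
  exact eq_neg_of_add_eq_zero_right h

/-- The terms `z0` in `σ(-+)` and `σ(+-)` cancel in the sum, and the other sums of braidings are
likewise symmetric; so these three forms behave classically. -/
theorem omega_mul_omega :
    omega q 0 * omega q 0 = 0 ∧ omega q 2 * omega q 2 = 0 ∧ omega q 3 * omega q 3 = 0 ∧
    omega q 2 * omega q 0 = -(omega q 0 * omega q 2) ∧
    omega q 3 * omega q 0 = -(omega q 0 * omega q 3) ∧
    omega q 3 * omega q 2 = -(omega q 2 * omega q 3) := by
  refine ⟨omega_sq q _ ?_, omega_sq q _ ?_, omega_sq q _ ?_, omega_anticomm q _ _ ?_,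
    omega_anticomm q _ _ ?_, omega_anticomm q _ _ ?_⟩ <;> simp only [braid_apply] <;> module

/-- The rows `-`, `+`, `0` of `f` have no entry in column `z`, so no `ω_z` appears. -/
theorem omega_mul_fn_apply (x : SU q) :
    omega q 0 * fn q x = fn q x * omega q 0 +
      (qRt q)⁻¹ • (fn q (opK q (opE q x)) * omega q 3) ∧
    omega q 2 * fn q x = fn q x * omega q 2 +
      (qRt q)⁻¹ • (fn q (opF q (opK q x)) * omega q 3) ∧
    omega q 3 * fn q x = fn q (opK q (opK q x)) * omega q 3 := by
  refine ⟨?_, ?_, ?_⟩ <;> rw [omega_mul_fn] <;>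
    simp [Fin.sum_univ_four, opf, pow_two, smul_mul_assoc]

theorem mul_of_mul_eq {M : Type*} [Semigroup M] {a b c : M} (h : a * b = c) (t : M) :
    a * (b * t) = c * t := by
  rw [← h, mul_assoc]

/-- `x ω₋ + y ω₊ + z ω₀`. -/
def oneForm (x y z : SU q) : Forms q :=
  fn q x * omega q 0 + fn q y * omega q 2 + fn q z * omega q 3

/-- `x ω₋ ω₊ + y ω₋ ω₀ + z ω₊ ω₀`. -/
def twoForm (x y z : SU q) : Forms q :=
  fn q x * (omega q 0 * omega q 2) + fn q y * (omega q 0 * omega q 3) +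
    fn q z * (omega q 2 * omega q 3)

/-- `x ω₋ ω₊ ω₀`. -/
def threeForm (x : SU q) : Forms q :=
  fn q x * (omega q 0 * (omega q 2 * omega q 3))

theorem oneForm_mul_oneForm (x y z a b c : SU q) :
    oneForm q x y z * oneForm q a b c = twoForm q (x * b - y * a)
      (x * c - (qRt q)⁻¹ • (x * opK q (opE q a)) - (qRt q)⁻¹ • (y * opF q (opK q a)) -
        z * opK q (opK q a))
      (y * c - (qRt q)⁻¹ • (x * opK q (opE q b)) - (qRt q)⁻¹ • (y * opF q (opK q b)) -
        z * opK q (opK q b)) := by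
  obtain ⟨h1, h2, h3, h4, h5, h6⟩ := omega_mul_omega q
  have hf x := omega_mul_fn_apply q x
  have hf1 x := mul_of_mul_eq (hf x).1
  have hf2 x := mul_of_mul_eq (hf x).2.1
  have hf3 x := mul_of_mul_eq (hf x).2.2
  simp only [oneForm, twoForm, mul_add, add_mul, mul_assoc, hf1, hf2, hf3, map_sub, map_mul,
    map_smul, sub_mul, smul_mul_assoc, mul_smul_comm, h1, h2, h3, h4, h5, h6, mul_zero, mul_neg]
  module

theorem twoForm_mul_oneForm (x y z a b c : SU q) :
    twoForm q x y z * oneForm q a b c = threeForm q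
      (x * c - (qRt q)⁻¹ • (x * opK q (opE q a)) - (qRt q)⁻¹ • (x * opF q (opK q b)) -
        y * opK q (opK q b) + z * opK q (opK q a)) := by
  obtain ⟨h1, h2, h3, h4, h5, h6⟩ := omega_mul_omega q
  have hf x := omega_mul_fn_apply q x
  have hf1 x := mul_of_mul_eq (hf x).1
  have hf2 x := mul_of_mul_eq (hf x).2.1
  have hf3 x := mul_of_mul_eq (hf x).2.2
  have g1 := mul_of_mul_eq h1
  have g2 := mul_of_mul_eq h2
  have g3 := mul_of_mul_eq h3
  have g4 := mul_of_mul_eq h4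
  have g5 := mul_of_mul_eq h5
  have g6 := mul_of_mul_eq h6
  simp only [oneForm, twoForm, threeForm, mul_add, add_mul, mul_assoc, hf1, hf2, hf3, map_sub,
    map_add, map_mul, map_smul, sub_mul, smul_mul_assoc, mul_smul_comm, h1, h2, h3, h4, h5, h6,
    g1, g2, g3, g4, g5, g6, mul_zero, zero_mul, mul_neg, neg_mul, smul_add, neg_neg, smul_zero]
  module

theorem oneForm_mul_twoForm (a b c x y z : SU q) :
    oneForm q a b c * twoForm q x y z = threeForm q
      (a * z - b * y + c * opK q (opK q x) + (qRt q)⁻¹ • (a * opK q (opE q x)) +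
        (qRt q)⁻¹ • (b * opF q (opK q x))) := by
  obtain ⟨h1, h2, h3, h4, h5, h6⟩ := omega_mul_omega q
  have hf x := omega_mul_fn_apply q x
  have hf1 x := mul_of_mul_eq (hf x).1
  have hf2 x := mul_of_mul_eq (hf x).2.1
  have hf3 x := mul_of_mul_eq (hf x).2.2
  have g1 := mul_of_mul_eq h1
  have g2 := mul_of_mul_eq h2
  have g3 := mul_of_mul_eq h3
  have g4 := mul_of_mul_eq h4
  have g5 := mul_of_mul_eq h5
  have g6 := mul_of_mul_eq h6
  simp only [oneForm, twoForm, threeForm, mul_add, add_mul, mul_assoc, hf1, hf2, hf3, map_sub,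
    map_add, map_mul, map_smul, sub_mul, smul_mul_assoc, mul_smul_comm, h1, h2, h3, h4, h5, h6,
    g1, g2, g3, g4, g5, g6, mul_zero, zero_mul, mul_neg, neg_mul, smul_add, neg_neg, smul_zero]
  module

theorem threeForm_mul_fn (x y : SU q) :
    threeForm q x * fn q y = threeForm q (x * opK q (opK q y)) := by
  obtain ⟨h1, h2, h3, h4, h5, h6⟩ := omega_mul_omega q
  have hf x := omega_mul_fn_apply q x
  have hf1 x := mul_of_mul_eq (hf x).1
  have hf2 x := mul_of_mul_eq (hf x).2.1
  have g6 := mul_of_mul_eq h6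
  simp only [threeForm, mul_add, add_mul, mul_assoc, hf, hf1, hf2, map_mul, smul_mul_assoc,
    mul_smul_comm, h3, h6, g6, mul_zero, mul_neg, neg_mul, smul_zero, neg_zero, add_zero]

theorem threeForm_eq_zero {x : SU q} (h : threeForm q x = 0) : x = 0 :=
  eq_zero_of_fn_mul_volume x h

end forms

/-! ### The forms on the sphere: products and `K`-weights -/

section sphere

variable {q : Set.Ioo (0 : ℝ) 1}

theorem mem_sphere {x : SU q} : x ∈ sphere q ↔ opK q x = x :=
  Iff.rfl

theorem opKinv_of_mem_sphere {x : SU q} (hx : x ∈ sphere q) : opKinv q x = x := by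
  conv_lhs => rw [← mem_sphere.1 hx, opKinv_opK]

theorem diff_of_mem_sphere {x : SU q} (hx : x ∈ sphere q) :
    diff q x = oneForm q (qRt q • opF q x) ((qRt q)⁻¹ • opE q x) (opF q (opE q x)) := by
  simp [diff, oneForm, opL, Fin.sum_univ_four, pow_two, opKinv_of_mem_sphere hx, mem_sphere.1 hx]

/-- In the `ω₀` coefficient, the cross terms `q (F ▷ x)(E ▷ y)` and `q⁻¹ (E ▷ x)(F ▷ y)` of `FE ▷ (x
y)` are exactly what arises from moving `ω₋` and `ω₊` past `y`. -/
theorem diff_mul {x y : SU q} (hx : x ∈ sphere q) (hy : y ∈ sphere q) :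
    diff q (x * y) = diff q x * fn q y + fn q x * diff q y := by
  have hs := qRt_ne_zero q
  have hq := qC_ne_zero q
  have hf x := omega_mul_fn_apply q x
  rw [diff_of_mem_sphere hx, diff_of_mem_sphere hy, diff_of_mem_sphere (mul_mem hx hy)]
  simp only [oneForm, opE_mul, opF_mul, opK_mul, opKinv_mul, mem_sphere.1 hx, mem_sphere.1 hy,
    opKinv_of_mem_sphere hx, opKinv_of_mem_sphere hy, opKinv_opE, opK_opE, map_add, map_smul,
    map_mul, add_mul, mul_add, mul_assoc, hf, smul_mul_assoc, mul_smul_comm, smul_add, smul_smul]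
  match_scalars <;> field_simp
  rw [pow_two, qRt_mul_self]

/-- The functions on the sphere, as forms. -/
def sphereFn (q : Set.Ioo (0 : ℝ) 1) : Submodule ℂ (Forms q) :=
  (Subalgebra.toSubmodule (sphere q)).map (fn q).toLinearMap

/-- The exact 1-forms on the sphere. -/
def sphereDiff (q : Set.Ioo (0 : ℝ) 1) : Submodule ℂ (Forms q) :=
  (Subalgebra.toSubmodule (sphere q)).map (diff q)

theorem sphereForms_eq (k : ℕ) : sphereForms q k = sphereFn q * sphereDiff q ^ k :=
  rfl

theorem fn_mem_sphereFn {x : SU q} (hx : x ∈ sphere q) : fn q x ∈ sphereFn q :=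
  Submodule.mem_map_of_mem (f := (fn q).toLinearMap) hx

theorem diff_mem_sphereDiff {x : SU q} (hx : x ∈ sphere q) : diff q x ∈ sphereDiff q :=
  Submodule.mem_map_of_mem (f := diff q) hx

theorem one_le_sphereFn : 1 ≤ sphereFn q := by
  rw [Submodule.one_le, ← map_one (fn q)]
  exact fn_mem_sphereFn (one_mem _)

theorem sphereFn_mul_self : sphereFn q * sphereFn q = sphereFn q := by
  refine le_antisymm (Submodule.mul_le.2 ?_) ?_
  · rintro _ ⟨x, hx, rfl⟩ _ ⟨y, hy, rfl⟩
    change fn q x * fn q y ∈ _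
    rw [← map_mul]
    exact fn_mem_sphereFn (mul_mem hx hy)
  · conv_lhs => rw [← one_mul (sphereFn q)]
    exact mul_le_mul_left one_le_sphereFn _

theorem sphereDiff_mul_sphereFn_le : sphereDiff q * sphereFn q ≤ sphereFn q * sphereDiff q := by
  refine Submodule.mul_le.2 ?_
  rintro _ ⟨x, hx, rfl⟩ _ ⟨y, hy, rfl⟩
  change diff q x * fn q y ∈ _
  rw [eq_sub_of_add_eq (diff_mul hx hy).symm]
  refine sub_mem ?_ (Submodule.mul_mem_mul (fn_mem_sphereFn hx) (diff_mem_sphereDiff hy))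
  rw [← one_mul (diff q (x * y)), ← map_one (fn q)]
  exact Submodule.mul_mem_mul (fn_mem_sphereFn (one_mem _)) (diff_mem_sphereDiff (mul_mem hx hy))

theorem sphereDiff_pow_mul_sphereFn_le (k : ℕ) :
    sphereDiff q ^ k * sphereFn q ≤ sphereFn q * sphereDiff q ^ k := by
  induction k with
  | zero => simp
  | succ k ih =>
    calc sphereDiff q ^ (k + 1) * sphereFn q = sphereDiff q ^ k * (sphereDiff q * sphereFn q) := by
          rw [pow_succ, mul_assoc]
      _ ≤ sphereDiff q ^ k * (sphereFn q * sphereDiff q) := by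
          exact mul_le_mul_right sphereDiff_mul_sphereFn_le _
      _ = (sphereDiff q ^ k * sphereFn q) * sphereDiff q := (mul_assoc _ _ _).symm
      _ ≤ (sphereFn q * sphereDiff q ^ k) * sphereDiff q := by gcongr
      _ = sphereFn q * sphereDiff q ^ (k + 1) := by rw [mul_assoc, pow_succ]

/-- By the Leibniz rule `(d x) y = d(x y) - x d y`, functions can be collected on the left. Hence
products of sphere 1-forms are available as test forms. -/
theorem sphereForms_mul_le (j k : ℕ) : sphereForms q j * sphereForms q k ≤ sphereForms q (j + k) := by
  simp only [sphereForms_eq]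
  calc sphereFn q * sphereDiff q ^ j * (sphereFn q * sphereDiff q ^ k)
      = sphereFn q * (sphereDiff q ^ j * sphereFn q) * sphereDiff q ^ k := by
        simp only [mul_assoc]
    _ ≤ sphereFn q * (sphereFn q * sphereDiff q ^ j) * sphereDiff q ^ k := by
        exact mul_le_mul_left (mul_le_mul_right (sphereDiff_pow_mul_sphereFn_le j) _) _
    _ = sphereFn q * sphereFn q * (sphereDiff q ^ j * sphereDiff q ^ k) := by
        simp only [mul_assoc]
    _ = sphereFn q * sphereDiff q ^ (j + k) := by rw [sphereFn_mul_self, pow_add]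

theorem mul_mem_sphereForms {j k : ℕ} {η θ : Forms q} (hη : η ∈ sphereForms q j)
    (hθ : θ ∈ sphereForms q k) : η * θ ∈ sphereForms q (j + k) :=
  sphereForms_mul_le j k (Submodule.mul_mem_mul hη hθ)

theorem sphereForms_succ_induction {k : ℕ} {P : Forms q → Prop}
    (hadd : ∀ η θ, P η → P θ → P (η + θ))
    (hmul : ∀ η ∈ sphereForms q k, ∀ x ∈ sphere q, P (η * diff q x)) {θ : Forms q}
    (hθ : θ ∈ sphereForms q (k + 1)) : P θ := by
  rw [sphereForms_eq, pow_succ, ← mul_assoc] at hθ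
  refine Submodule.mul_induction_on hθ ?_ hadd
  rintro η hη _ ⟨x, hx, rfl⟩
  exact hmul η hη x hx

theorem mem_sphereForms_zero {θ : Forms q} : θ ∈ sphereForms q 0 ↔ ∃ x ∈ sphere q, θ = fn q x := by
  rw [sphereForms_eq, pow_zero, mul_one]
  exact ⟨fun ⟨x, hx, h⟩ => ⟨x, hx, h.symm⟩, fun ⟨x, hx, h⟩ => ⟨x, hx, h.symm⟩⟩

theorem fn_mul_mem_sphereForms {x : SU q} (hx : x ∈ sphere q) {k : ℕ} {θ : Forms q}
    (hθ : θ ∈ sphereForms q k) : fn q x * θ ∈ sphereForms q k := by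
  simpa using mul_mem_sphereForms (mem_sphereForms_zero.2 ⟨x, hx, rfl⟩) hθ

theorem fn_mul_diff_mem_sphereForms {x y : SU q} (hx : x ∈ sphere q) (hy : y ∈ sphere q) :
    fn q x * diff q y ∈ sphereForms q 1 := by
  rw [sphereForms_eq, pow_one]
  exact Submodule.mul_mem_mul (fn_mem_sphereFn hx) (diff_mem_sphereDiff hy)

theorem opK_diff_coeff {x : SU q} (hx : x ∈ sphere q) :
    opK q (qRt q • opF q x) = (qC q)⁻¹ • (qRt q • opF q x) ∧
      opK q ((qRt q)⁻¹ • opE q x) = qC q • ((qRt q)⁻¹ • opE q x) ∧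
      opK q (opF q (opE q x)) = opF q (opE q x) := by
  have hq := qC_ne_zero q
  simp [opK_opF, opK_opE, mem_sphere.1 hx, smul_comm (qRt q), smul_comm (qRt q)⁻¹, hq]

theorem fn_mul_oneForm (u x y z : SU q) :
    fn q u * oneForm q x y z = oneForm q (u * x) (u * y) (u * z) := by
  simp [oneForm, mul_add, mul_assoc]

theorem oneForm_add (x y z x' y' z' : SU q) :
    oneForm q x y z + oneForm q x' y' z' = oneForm q (x + x') (y + y') (z + z') := by
  simp only [oneForm, map_add, add_mul]
  abel

theorem twoForm_add (x y z x' y' z' : SU q) :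
    twoForm q x y z + twoForm q x' y' z' = twoForm q (x + x') (y + y') (z + z') := by
  simp only [twoForm, map_add, add_mul]
  abel

/-- `F` lowers and `E` raises the `K`-weight by a factor `q`, and functions on the sphere have
weight `1`. The weights are used later to remove `K` from the product formulas. -/
theorem exists_oneForm {θ : Forms q} (hθ : θ ∈ sphereForms q 1) :
    ∃ x y z, opK q x = (qC q)⁻¹ • x ∧ opK q y = qC q • y ∧ opK q z = z ∧
      θ = oneForm q x y z := by
  refine sphereForms_succ_induction (k := 0) (P := fun θ => ∃ x y z, opK q x = (qC q)⁻¹ • x ∧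
    opK q y = qC q • y ∧ opK q z = z ∧ θ = oneForm q x y z) ?_ ?_ hθ
  · rintro _ _ ⟨x, y, z, hx, hy, hz, rfl⟩ ⟨x', y', z', hx', hy', hz', rfl⟩
    exact ⟨x + x', y + y', z + z', by simp [*], by simp [*], by simp [*], oneForm_add _ _ _ _ _ _⟩
  · intro η hη x hx
    obtain ⟨u, hu, rfl⟩ := mem_sphereForms_zero.1 hη
    obtain ⟨h1, h2, h3⟩ := opK_diff_coeff hx
    rw [diff_of_mem_sphere hx, fn_mul_oneForm]
    have hu := mem_sphere.1 hu
    exact ⟨_, _, _, by rw [opK_mul, hu, h1, mul_smul_comm], by rw [opK_mul, hu, h2, mul_smul_comm],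
      by rw [opK_mul, hu, h3], rfl⟩

theorem exists_twoForm {θ : Forms q} (hθ : θ ∈ sphereForms q 2) :
    ∃ x y z, opK q x = x ∧ opK q y = (qC q)⁻¹ • y ∧ opK q z = qC q • z ∧
      θ = twoForm q x y z := by
  have hq := qC_ne_zero q
  refine sphereForms_succ_induction (k := 1) (P := fun θ => ∃ x y z, opK q x = x ∧
    opK q y = (qC q)⁻¹ • y ∧ opK q z = qC q • z ∧ θ = twoForm q x y z) ?_ ?_ hθ
  · rintro _ _ ⟨x, y, z, hx, hy, hz, rfl⟩ ⟨x', y', z', hx', hy', hz', rfl⟩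
    exact ⟨x + x', y + y', z + z', by simp [*], by simp [*], by simp [*], twoForm_add _ _ _ _ _ _⟩
  · intro η hη f hf
    obtain ⟨x, y, z, hx, hy, hz, rfl⟩ := exists_oneForm hη
    obtain ⟨h1, h2, h3⟩ := opK_diff_coeff hf
    rw [diff_of_mem_sphere hf]
    generalize qRt q • opF q f = a at *
    generalize (qRt q)⁻¹ • opE q f = b at *
    generalize opF q (opE q f) = c at *
    rw [oneForm_mul_oneForm]
    refine ⟨_, _, _, ?_, ?_, ?_, rfl⟩ <;>
    · simp only [map_sub, map_smul, opK_mul, opK_opE, opK_opF, hx, hy, hz, h1, h2, h3,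
        smul_mul_assoc, mul_smul_comm, smul_smul, smul_sub]
      match_scalars <;> field_simp

end sphere

/-! ### Test forms and non-degeneracy -/

section nondegenerate

variable (q : Set.Ioo (0 : ℝ) 1)

/-- The relations oriented towards normal ordering: `a` or `a^*` first, then `c^*`, then `c`. With
their associated forms they reduce identities between monomials to comparing coefficients. -/
theorem gen_reorder :
    gen q .c * gen q .a = (qC q)⁻¹ • (gen q .a * gen q .c) ∧
    gen q .cStar * gen q .a = (qC q)⁻¹ • (gen q .a * gen q .cStar) ∧
    gen q .c * gen q .cStar = gen q .cStar * gen q .c ∧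
    gen q .cStar * gen q .aStar = qC q • (gen q .aStar * gen q .cStar) ∧
    gen q .c * gen q .aStar = qC q • (gen q .aStar * gen q .c) ∧
    gen q .aStar * gen q .a = 1 - gen q .cStar * gen q .c ∧
    gen q .a * gen q .aStar = 1 - qC q ^ 2 • (gen q .cStar * gen q .c) := by
  have hq := qC_ne_zero q
  exact ⟨by rw [rel_a_c, inv_smul_smul₀ hq], by rw [rel_a_cStar, inv_smul_smul₀ hq], rel_c_cStar q,
    rel_cStar_aStar q, rel_c_aStar q, aStar_mul_a q, a_mul_aStar q⟩

theorem gen_reorder_assoc (t : SU q) :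
    gen q .c * (gen q .a * t) = (qC q)⁻¹ • (gen q .a * (gen q .c * t)) ∧
    gen q .cStar * (gen q .a * t) = (qC q)⁻¹ • (gen q .a * (gen q .cStar * t)) ∧
    gen q .c * (gen q .cStar * t) = gen q .cStar * (gen q .c * t) ∧
    gen q .cStar * (gen q .aStar * t) = qC q • (gen q .aStar * (gen q .cStar * t)) ∧
    gen q .c * (gen q .aStar * t) = qC q • (gen q .aStar * (gen q .c * t)) ∧
    gen q .aStar * (gen q .a * t) = t - gen q .cStar * (gen q .c * t) ∧
    gen q .a * (gen q .aStar * t) = t - qC q ^ 2 • (gen q .cStar * (gen q .c * t)) := by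
  obtain ⟨h1, h2, h3, h4, h5, h6, h7⟩ := gen_reorder q
  refine ⟨?_, ?_, ?_, ?_, ?_, ?_, ?_⟩ <;> rw [← mul_assoc]
  · rw [h1, smul_mul_assoc, mul_assoc]
  · rw [h2, smul_mul_assoc, mul_assoc]
  · rw [h3, mul_assoc]
  · rw [h4, smul_mul_assoc, mul_assoc]
  · rw [h5, smul_mul_assoc, mul_assoc]
  · rw [h6, sub_mul, one_mul, mul_assoc]
  · rw [h7, sub_mul, one_mul, smul_mul_assoc, mul_assoc]

/-- The elements `a c^*, c c^*, c a^*` spanning, with `1`, the quadratic functions on the sphere. -/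
def quad : Fin 3 → SU q :=
  ![gen q .a * gen q .cStar, gen q .c * gen q .cStar, gen q .c * gen q .aStar]

/-- The elements `a², c a, c²`. -/
def quadMinus : Fin 3 → SU q :=
  ![gen q .a * gen q .a, gen q .c * gen q .a, gen q .c * gen q .c]

/-- The elements `a^*², a^* c^*, c^*²`. -/
def quadPlus : Fin 3 → SU q :=
  ![gen q .aStar * gen q .aStar, gen q .aStar * gen q .cStar, gen q .cStar * gen q .cStar]

variable {q}

theorem quad_mem (i : Fin 3) : quad q i ∈ sphere q := by
  have hs := qRt_ne_zero q
  rw [mem_sphere]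
  fin_cases i <;> simp [quad, opK_mul, opK_gen, smul_smul, hs]

theorem opK_quadMinus (i : Fin 3) : opK q (quadMinus q i) = (qC q)⁻¹ • quadMinus q i := by
  fin_cases i <;> simp [quadMinus, opK_mul, opK_gen, smul_smul, ← qRt_mul_self]

theorem opK_quadPlus (i : Fin 3) : opK q (quadPlus q i) = qC q • quadPlus q i := by
  fin_cases i <;> simp [quadPlus, opK_mul, opK_gen, smul_smul, ← qRt_mul_self]

theorem mul_mem_sphere {x y : SU q} (hx : opK q x = (qC q)⁻¹ • x) (hy : opK q y = qC q • y) :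
    x * y ∈ sphere q ∧ y * x ∈ sphere q := by
  have hq := qC_ne_zero q
  simp [mem_sphere, opK_mul, hx, hy, smul_smul, hq]

/-- Insert `1 = a^*a + c^*c` in the middle of both terms of `a^*a + c^*c = 1`. The mixed terms
combine through `c^*a^* = q a^*c^*` and `ac = q ca`, giving `1 + q²`. -/
theorem sum_quadPlus_mul_quadMinus :
    quadPlus q 0 * quadMinus q 0 + (1 + qC q ^ 2) • (quadPlus q 1 * quadMinus q 1) +
      quadPlus q 2 * quadMinus q 2 = 1 := by
  have hq := qC_ne_zero q
  simp only [quadPlus, quadMinus, Matrix.cons_val, mul_assoc, gen_reorder, gen_reorder_assoc, mul_sub,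
      mul_smul_comm,
    smul_mul_assoc, smul_smul, smul_sub, mul_one]
  match_scalars <;> field_simp <;> ring

/-- The same with `aa^* + q²cc^* = 1` inserted into itself. -/
theorem sum_quadMinus_mul_quadPlus :
    quadMinus q 0 * quadPlus q 0 + (qC q ^ 2 + qC q ^ 4) • (quadMinus q 1 * quadPlus q 1) +
      qC q ^ 4 • (quadMinus q 2 * quadPlus q 2) = 1 := by
  have hq := qC_ne_zero q
  simp only [quadPlus, quadMinus, Matrix.cons_val, mul_assoc, gen_reorder, gen_reorder_assoc, mul_sub,
      mul_smul_comm,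
    smul_mul_assoc, smul_smul, smul_sub, mul_one]
  match_scalars <;> field_simp <;> ring

theorem eq_zero_of_quadMinus_mul {x : SU q} (h : ∀ i, quadMinus q i * x = 0) : x = 0 := by
  rw [← one_mul x, ← sum_quadPlus_mul_quadMinus]
  simp [add_mul, mul_assoc, h]

theorem eq_zero_of_quadPlus_mul {x : SU q} (h : ∀ i, quadPlus q i * x = 0) : x = 0 := by
  rw [← one_mul x, ← sum_quadMinus_mul_quadPlus]
  simp [add_mul, mul_assoc, h]

theorem diff_quad :
    diff q (quad q 0) = oneForm q (-quadMinus q 0) (-(qC q • quadPlus q 2))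
      ((qC q + (qC q)⁻¹) • quad q 0) ∧
    diff q (quad q 1) = oneForm q (-quadMinus q 1) (quadPlus q 1)
      ((qC q + (qC q)⁻¹) • quad q 1 - (qC q)⁻¹ • 1) ∧
    diff q (quad q 2) = oneForm q (qC q • quadMinus q 2) (quadPlus q 0)
      ((qC q + (qC q)⁻¹) • quad q 2) := by
  have hs := qRt_ne_zero q
  refine ⟨?_, ?_, ?_⟩ <;>
  · rw [diff_of_mem_sphere (quad_mem _)]
    congr 1
    all_goals
      simp only [quad, quadPlus, quadMinus, Matrix.cons_val, opE_mul, opF_mul, opK_gen, opKinv_gen,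
        opE_gen, opF_gen, map_add, map_neg, map_smul, map_zero, mul_assoc, gen_reorder, gen_reorder_assoc, mul_sub,

        mul_smul_comm, smul_mul_assoc, smul_smul, smul_sub, smul_add, mul_neg, neg_mul, smul_neg,
        zero_mul, mul_zero, ← qRt_mul_self]
      match_scalars <;> field_simp <;> try ring

/-- The scalars are those of `sum_quadPlus_mul_quadMinus`, divided by the factors `-1, -1, q` with
which `quadMinus` enters `diff_quad`. This makes the `ω₋` coefficient `1`, and the other two
coefficients cancel. The functions `quadPlus` are not on the sphere; they become so after
multiplication by a function of weight `q⁻¹`. -/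
theorem omega_minus_eq :
    -(fn q (quadPlus q 0) * diff q (quad q 0)) -
      (1 + qC q ^ 2) • (fn q (quadPlus q 1) * diff q (quad q 1)) +
      (qC q)⁻¹ • (fn q (quadPlus q 2) * diff q (quad q 2)) = omega q 0 := by
  have hq := qC_ne_zero q
  have hsmul (r : ℂ) (x y z : SU q) : r • oneForm q x y z = oneForm q (r • x) (r • y) (r • z) := by
    simp [oneForm]
  rw [sub_eq_add_neg, ← neg_one_smul ℂ (fn q (quadPlus q 0) * _), ← neg_smul]
  simp only [diff_quad, fn_mul_oneForm, hsmul, oneForm_add]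
  trans oneForm q 1 0 0
  swap
  · simp [oneForm]
  congr 1
  · rw [← sum_quadPlus_mul_quadMinus]
    simp only [mul_neg, mul_smul_comm, smul_neg, smul_smul]
    match_scalars <;> field_simp
  all_goals
    simp only [quad, quadPlus, Matrix.cons_val, mul_assoc, gen_reorder, gen_reorder_assoc, mul_sub,
      mul_add, mul_one, mul_smul_comm, smul_mul_assoc, smul_smul, smul_sub, smul_add, mul_neg,
      smul_neg]
    match_scalars <;> field_simp <;> try ring

/-- As for `ω₋`, with the scalars of `sum_quadMinus_mul_quadPlus` divided by the factors of
`quadPlus` in `diff_quad`. -/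
theorem omega_plus_eq :
    -qC q ^ 3 • (fn q (quadMinus q 2) * diff q (quad q 0)) +
      (qC q ^ 2 + qC q ^ 4) • (fn q (quadMinus q 1) * diff q (quad q 1)) +
      (fn q (quadMinus q 0) * diff q (quad q 2)) = omega q 2 := by
  have hq := qC_ne_zero q
  have hsmul (r : ℂ) (x y z : SU q) : r • oneForm q x y z = oneForm q (r • x) (r • y) (r • z) := by
    simp [oneForm]
  simp only [diff_quad, fn_mul_oneForm, hsmul, oneForm_add]
  trans oneForm q 0 1 0
  swap
  · simp [oneForm]
  congr 1
  · simp only [quadMinus, Matrix.cons_val, mul_assoc, gen_reorder, gen_reorder_assoc, mul_sub,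
      mul_add, mul_one, mul_smul_comm, smul_mul_assoc, smul_smul, smul_sub, smul_add, mul_neg,
      smul_neg]
    match_scalars
    field_simp
    ring
  · rw [← sum_quadMinus_mul_quadPlus]
    simp only [mul_neg, mul_smul_comm, smul_neg, smul_smul]
    match_scalars <;> field_simp
  · simp only [quad, quadMinus, Matrix.cons_val, mul_assoc, gen_reorder, gen_reorder_assoc, mul_sub,
      mul_add, mul_one, mul_smul_comm, smul_mul_assoc, smul_smul, smul_sub, smul_add, mul_neg,
      smul_neg]
    match_scalars <;> field_simp <;> try ring

theorem fn_mul_omega_minus_mem {y : SU q} (hy : opK q y = (qC q)⁻¹ • y) :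
    fn q y * omega q 0 ∈ sphereForms q 1 := by
  have h (i j : Fin 3) : fn q y * (fn q (quadPlus q i) * diff q (quad q j)) ∈ sphereForms q 1 := by
    rw [← mul_assoc, ← map_mul]
    exact fn_mul_diff_mem_sphereForms (mul_mem_sphere hy (opK_quadPlus i)).1 (quad_mem j)
  rw [← omega_minus_eq, mul_add, mul_sub, mul_neg, mul_smul_comm, mul_smul_comm]
  exact add_mem (sub_mem (neg_mem (h _ _)) (Submodule.smul_mem _ _ (h _ _)))
    (Submodule.smul_mem _ _ (h _ _))

theorem fn_mul_omega_plus_mem {y : SU q} (hy : opK q y = qC q • y) :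
    fn q y * omega q 2 ∈ sphereForms q 1 := by
  have h (i j : Fin 3) : fn q y * (fn q (quadMinus q i) * diff q (quad q j)) ∈ sphereForms q 1 := by
    rw [← mul_assoc, ← map_mul]
    exact fn_mul_diff_mem_sphereForms (mul_mem_sphere (opK_quadMinus i) hy).2 (quad_mem j)
  rw [← omega_plus_eq, mul_add, mul_add, mul_smul_comm, mul_smul_comm]
  exact add_mem (add_mem (Submodule.smul_mem _ _ (h _ _)) (Submodule.smul_mem _ _ (h _ _)))
    (h _ _)

theorem fn_mul_omega_zero_mem {x y z : SU q} (hx : opK q x = (qC q)⁻¹ • x)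
    (hy : opK q y = qC q • y) (h : oneForm q x y z ∈ sphereForms q 1) :
    fn q z * omega q 3 ∈ sphereForms q 1 := by
  have h1 := sub_mem (sub_mem h (fn_mul_omega_minus_mem hx)) (fn_mul_omega_plus_mem hy)
  convert h1 using 1
  simp only [oneForm]
  abel

/-- Removing the `ω₋` and `ω₊` parts from `d(ac^*)` and `d(cc^*)` leaves two sphere forms `z ω₀`;
their coefficients `z` generate the unit left ideal of the sphere algebra. -/
theorem omega_zero_mem : omega q 3 ∈ sphereForms q 1 := by
  have hq := qC_ne_zero q
  have hd (i : Fin 3) : diff q (quad q i) ∈ sphereForms q 1 := by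
    simpa using fn_mul_diff_mem_sphereForms (one_mem (sphere q)) (quad_mem i)
  obtain ⟨d0, d1, d2⟩ := diff_quad (q := q)
  have h0 := hd 0
  have h1 := hd 1
  rw [d0] at h0
  rw [d1] at h1
  replace h0 := fn_mul_omega_zero_mem (by simp [opK_quadMinus]) (by
    rw [map_neg, map_smul, opK_quadPlus, smul_neg]) h0
  replace h1 := fn_mul_omega_zero_mem (by simp [opK_quadMinus]) (opK_quadPlus 1) h1
  have h2 := fn_mul_mem_sphereForms (quad_mem 2) h0
  have h3 := fn_mul_mem_sphereForms (quad_mem 1) h1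
  -- With `B = cc^*`, one has `(ca^*)(ac^*) = B - B²`. So the terms quadratic in `B` cancel, the
  -- linear ones cancel because both carry `(q + q⁻¹)²`, and `q · q⁻¹ = 1` is left.
  have key : (qC q + (qC q)⁻¹) • (quad q 2 * ((qC q + (qC q)⁻¹) • quad q 0) +
      quad q 1 * ((qC q + (qC q)⁻¹) • quad q 1 - (qC q)⁻¹ • 1)) -
      qC q • ((qC q + (qC q)⁻¹) • quad q 1 - (qC q)⁻¹ • 1) = 1 := by
    simp only [quad, Matrix.cons_val, mul_assoc, gen_reorder, gen_reorder_assoc, mul_sub, mul_one,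
      mul_smul_comm, smul_mul_assoc, smul_smul, smul_sub, smul_add]
    match_scalars <;> field_simp <;> ring
  have h4 := sub_mem (Submodule.smul_mem _ (qC q + (qC q)⁻¹) (add_mem h2 h3))
    (Submodule.smul_mem _ (qC q) h1)
  rwa [← mul_assoc, ← mul_assoc, ← add_mul, ← map_mul, ← map_mul, ← map_add, ← smul_mul_assoc,
    ← smul_mul_assoc, ← sub_mul, ← map_smul, ← map_smul, ← map_sub, key, map_one, one_mul] at h4

theorem quadMinus_mem (i : Fin 3) : oneForm q (quadMinus q i) 0 0 ∈ sphereForms q 1 := by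
  simpa [oneForm] using fn_mul_omega_minus_mem (opK_quadMinus i)

theorem quadPlus_mem (i : Fin 3) : oneForm q 0 (quadPlus q i) 0 ∈ sphereForms q 1 := by
  simpa [oneForm] using fn_mul_omega_plus_mem (opK_quadPlus i)

theorem oneForm_zero_mem : oneForm q 0 0 1 ∈ sphereForms q 1 := by
  simpa [oneForm] using omega_zero_mem

theorem eq_zero_of_quadMinus_mul_quadPlus_mul {x : SU q}
    (h : ∀ i j, quadMinus q i * quadPlus q j * x = 0) : x = 0 :=
  eq_zero_of_quadPlus_mul fun j => eq_zero_of_quadMinus_mul fun i => by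
    rw [← mul_assoc, h]

theorem opK_one : opK q 1 = 1 := map_one (actK q)

/-- The test forms are `y ω₋ ∧ y' ω₊ ∧ ω₀`, with `y` in `quadMinus` and `y'` in `quadPlus`. -/
theorem fn_eq_zero {x : SU q} (hx : x ∈ sphere q)
    (h : ∀ θ' ∈ sphereForms q 3, θ' * fn q x = 0) : x = 0 := by
  refine eq_zero_of_quadMinus_mul_quadPlus_mul fun i j => ?_
  have h1 := h _ (mul_mem_sphereForms (j := 2) (k := 1)
    (mul_mem_sphereForms (j := 1) (k := 1) (quadMinus_mem i) (quadPlus_mem j)) oneForm_zero_mem)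
  rw [oneForm_mul_oneForm, twoForm_mul_oneForm, threeForm_mul_fn, mem_sphere.1 hx,
    mem_sphere.1 hx] at h1
  simpa using threeForm_eq_zero q h1

/-- Wedging with `ω₋ω₀` and `ω₊ω₀`, weighted by `quadMinus` and `quadPlus`, isolates `y` and `x` up
to a power of `q`. They go first, because the test with `ω₋ω₊` also produces derivatives of `x` and
`y` next to `z`. -/
theorem oneForm_eq_zero {x y z : SU q} (hx : opK q x = (qC q)⁻¹ • x) (hy : opK q y = qC q • y)
    (h : ∀ θ' ∈ sphereForms q 2, θ' * oneForm q x y z = 0) : oneForm q x y z = 0 := by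
  have hq := qC_ne_zero q
  obtain rfl : y = 0 := by
    refine eq_zero_of_quadMinus_mul fun i => ?_
    have h1 := h _ (mul_mem_sphereForms (j := 1) (k := 1) (quadMinus_mem i) oneForm_zero_mem)
    rw [oneForm_mul_oneForm, twoForm_mul_oneForm] at h1
    simpa [hy, opK_one, hq] using threeForm_eq_zero q h1
  obtain rfl : x = 0 := by
    refine eq_zero_of_quadPlus_mul fun i => ?_
    have h1 := h _ (mul_mem_sphereForms (j := 1) (k := 1) (quadPlus_mem i) oneForm_zero_mem)
    rw [oneForm_mul_oneForm, twoForm_mul_oneForm] at h1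
    simpa [hx, opK_one, hq] using threeForm_eq_zero q h1
  obtain rfl : z = 0 := by
    refine eq_zero_of_quadMinus_mul_quadPlus_mul fun i j => ?_
    have h1 := h _ (mul_mem_sphereForms (j := 1) (k := 1) (quadMinus_mem i) (quadPlus_mem j))
    rw [oneForm_mul_oneForm, twoForm_mul_oneForm] at h1
    simpa using threeForm_eq_zero q h1
  simp [oneForm]

/-- Wedging with `ω₀` isolates `x`. Once `x = 0`, its derivatives disappear from the products with
`ω₋` and `ω₊`, which then isolate `z` and `y`. -/
theorem twoForm_eq_zero {x y z : SU q} (hx : opK q x = x)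
    (h : ∀ θ' ∈ sphereForms q 1, θ' * twoForm q x y z = 0) : twoForm q x y z = 0 := by
  obtain rfl : x = 0 := by
    have h1 := h _ oneForm_zero_mem
    rw [oneForm_mul_twoForm] at h1
    simpa [hx] using threeForm_eq_zero q h1
  obtain rfl : z = 0 := by
    refine eq_zero_of_quadMinus_mul fun i => ?_
    have h1 := h _ (quadMinus_mem i)
    rw [oneForm_mul_twoForm] at h1
    simpa using threeForm_eq_zero q h1
  obtain rfl : y = 0 := by
    refine eq_zero_of_quadPlus_mul fun i => ?_
    have h1 := h _ (quadPlus_mem i)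
    rw [oneForm_mul_twoForm] at h1
    simpa using threeForm_eq_zero q h1
  simp [twoForm]

end nondegenerate

end QSphere

end

theorem lemma4p1 (q : Set.Ioo (0 : ℝ) 1) (k : ℕ) (hk : k ≤ 3) (θ : QSphere.Forms q)
    (hθ : θ ∈ QSphere.sphereForms q k)
    (h : ∀ θ' ∈ QSphere.sphereForms q (3 - k), θ' * θ = 0) : θ = 0 := by
  obtain rfl | rfl | rfl | rfl : k = 0 ∨ k = 1 ∨ k = 2 ∨ k = 3 := by omega
  · obtain ⟨x, hx, rfl⟩ := QSphere.mem_sphereForms_zero.1 hθ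
    rw [QSphere.fn_eq_zero hx h, map_zero]
  · obtain ⟨x, y, z, hx, hy, -, rfl⟩ := QSphere.exists_oneForm hθ
    exact QSphere.oneForm_eq_zero hx hy h
  · obtain ⟨x, y, z, hx, -, -, rfl⟩ := QSphere.exists_twoForm hθ
    exact QSphere.twoForm_eq_zero hx h
  · have h1 := h 1 (QSphere.mem_sphereForms_zero.2 ⟨1, one_mem _, (map_one _).symm⟩)
    rwa [one_mul] at h1
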